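/- For a skew shape $\lambda/\mu$ let $s_{\lambda/\mu}=\sum_T x^T$ be its skew Schur function, the sum over all semistandard Young tableaux $T$ of shape $\lambda/\mu$ (rows weakly increasing from left to right, columns strictly increasing from top to bottom), where $x^T=\prod_k x_k^{\#\{k\text{'s in }T\}}$. Write $s_{\lambda/\mu}=\sum_\nu c_\nu s_\nu$ for its unique expansion into Schur functions $s_\nu$ of straight shapes $\nu$. The Schur support of $\lambda/\mu$ is $[\lambda/\mu]=\{\nu : c_\nu>0\}$. For positive integers $\alpha_1,\dots,\alpha_m$, the ribbon $\alpha=(\alpha_1,\dots,\alpha_m)$ is the connected skew shape containing no $2\times 2$ block of boxes and having $m$ rows, of lengths $\alpha_1,\dots,\alpha_m$ from top to bottom. Let $\alpha_{(i\;i+1)}$ denote the ribbon obtained from $\alpha$ by interchanging the row lengths $\alpha_i$ and $\alpha_{i+1}$. **Theorem.** Let $\alpha=(\alpha_1,\dots,\alpha_m)$ be a ribbon with $m\ge 3$ and $\alpha_k\ge 2$ for all $k$. Let $1\le i\le m-1$, and suppose that $\alpha_i>\alpha_{i+1}$ and $\alpha_i<\alpha_{i-1}+\alpha_{i+1}$,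 where $\alpha_0=\infty$ (so the second inequality is vacuous for $i=1$). Then $$[\alpha]\subseteq[\alpha_{(i\;i+1)}].$$ -/

import Mathlib

/-- A skew shape `outer / inner`: a pair of Young diagrams with `inner ⊆ outer`. Rows are numbered
from the top and columns from the left, both starting at `0`. -/
structure SkewShape where
  outer : YoungDiagram
  inner : YoungDiagram
  inner_le : inner ≤ outer

namespace SkewShape

/-- The boxes of a skew shape. -/
def cells (S : SkewShape) : Finset (ℕ × ℕ) := S.outer.cells \ S.inner.cells

end SkewShape

/-- A semistandard tableau of skew shape `S`: a filling of the boxes of `S` that increases weakly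
along rows (left to right) and strictly down columns. As for `SemistandardYoungTableau`, entries are
natural numbers (the usual alphabet `1, 2, 3, …` is shifted to `0, 1, 2, …`), and the filling is
extended by zero outside the shape. -/
@[ext]
structure SkewTableau (S : SkewShape) where
  entry : ℕ → ℕ → ℕ
  row_weak : ∀ {i j₁ j₂ : ℕ}, j₁ < j₂ → (i, j₁) ∈ S.cells → (i, j₂) ∈ S.cells →
    entry i j₁ ≤ entry i j₂
  col_strict : ∀ {i₁ i₂ j : ℕ}, i₁ < i₂ → (i₁, j) ∈ S.cells → (i₂, j) ∈ S.cells →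
    entry i₁ j < entry i₂ j
  zeros : ∀ {i j : ℕ}, (i, j) ∉ S.cells → entry i j = 0

/-- The content of a filling `T` of a finite set of boxes: `fillingContent s T k` is the number of
boxes of `s` with entry `k`. -/
noncomputable def fillingContent (s : Finset (ℕ × ℕ)) (T : ℕ → ℕ → ℕ) : ℕ →₀ ℕ :=
  ∑ c ∈ s, Finsupp.single (T c.1 c.2) 1

theorem fillingContent_apply (s : Finset (ℕ × ℕ)) (T : ℕ → ℕ → ℕ) (k : ℕ) :
    fillingContent s T k = (s.filter fun c => T c.1 c.2 = k).card := by
  classical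
  simp [fillingContent, Finsupp.finsetSum_apply, Finsupp.single_apply, Finset.sum_boole]

/-- Only finitely many skew tableaux have a given content, so that the coefficients of
`skewSchur` are genuine cardinalities. -/
theorem finite_skewTableau_content (S : SkewShape) (t : ℕ →₀ ℕ) :
    Finite {T : SkewTableau S // fillingContent S.cells T.entry = t} := by
  classical
  have key : ∀ T : {T : SkewTableau S // fillingContent S.cells T.entry = t},
      ∀ c : S.cells, T.1.entry c.1.1 c.1.2 ∈ t.support := by
    rintro ⟨T, hT⟩ ⟨c, hc⟩
    subst hT
    rw [Finsupp.mem_support_iff, fillingContent_apply]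
    exact Finset.card_ne_zero.mpr ⟨c, by simp [hc]⟩
  refine Finite.of_injective
    (fun T => fun c : S.cells => (⟨T.1.entry c.1.1 c.1.2, key T c⟩ : t.support)) ?_
  rintro ⟨T, hT⟩ ⟨T', hT'⟩ h
  refine Subtype.ext (SkewTableau.ext (funext fun i => funext fun j => ?_))
  by_cases hc : (i, j) ∈ S.cells
  · exact congrArg Subtype.val (congrFun h ⟨(i, j), hc⟩)
  · rw [T.zeros hc, T'.zeros hc]

/-- The skew Schur function `s_S = ∑_T x^T`, the sum over semistandard tableaux `T` of skew shape
`S`, as a power series in the variables `x_0, x_1, x_2, …`: the coefficient of `x^t` is the number of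
such `T` with content `t`. -/
noncomputable def skewSchur (S : SkewShape) : MvPowerSeries ℕ ℤ :=
  fun t => (Nat.card {T : SkewTableau S // fillingContent S.cells T.entry = t} : ℤ)

/-- The Schur function `s_ν = ∑_T x^T`, the sum over semistandard Young tableaux `T` of shape `ν`. -/
noncomputable def schur (ν : YoungDiagram) : MvPowerSeries ℕ ℤ :=
  fun t => (Nat.card {T : SemistandardYoungTableau ν // fillingContent ν.cells T.entry = t} : ℤ)

/-- The Schur support of a skew shape `S`: the set of straight shapes `ν` whose coefficient in the
expansion `s_S = ∑_ν c_ν s_ν` into Schur functions is positive. -/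
def schurSupport (S : SkewShape) : Set YoungDiagram :=
  {ν | ∃ c : YoungDiagram →₀ ℤ, skewSchur S = (c.sum fun κ a => a • schur κ) ∧ 0 < c ν}

namespace Ribbon

variable {m : ℕ}

/-- The number of columns to the left of row `i` in the ribbon with row lengths `α`: consecutive
rows share exactly one column, so each lower row `j` contributes `α j - 1`. -/
def offset (α : Fin m → ℕ) (i : Fin m) : ℕ := ∑ j ∈ Finset.Ioi i, (α j - 1)

theorem offset_antitone (α : Fin m → ℕ) : Antitone (offset α) := fun _ _ h =>
  Finset.sum_le_sum_of_subset (Finset.Ioi_subset_Ioi h)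

theorem offset_add_antitone (α : Fin m → ℕ) :
    Antitone fun i => offset α i + (α i - 1) + 1 := by
  intro a b h
  have key : ∀ i, offset α i + (α i - 1) = ∑ j ∈ Finset.Ici i, (α j - 1) := by
    intro i
    rw [offset, ← Finset.Ioi_insert, Finset.sum_insert (by simp), add_comm]
  simp only [key]
  exact Nat.add_le_add_right
    (Finset.sum_le_sum_of_subset (Finset.Ici_subset_Ici.mpr h)) 1

/-- The ribbon with `m` rows whose row lengths, from top to bottom, are the positive integers
`α 0, …, α (m - 1)`: row `i` occupies the columns `offset α i, …, offset α i + α i - 1`. -/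
def shape (α : Fin m → ℕ) : SkewShape where
  outer := YoungDiagram.ofRowLens (List.ofFn fun i => offset α i + (α i - 1) + 1)
    (offset_add_antitone α).sortedGE_ofFn
  inner := YoungDiagram.ofRowLens (List.ofFn (offset α)) (offset_antitone α).sortedGE_ofFn
  inner_le := by
    intro c hc
    obtain ⟨h, hlt⟩ := YoungDiagram.mem_ofRowLens.mp hc
    refine YoungDiagram.mem_ofRowLens.mpr ⟨by simpa using h, ?_⟩
    simp only [List.getElem_ofFn] at hlt ⊢
    omega

theorem mem_shape_cells {α : Fin m → ℕ} (hα : ∀ i, 0 < α i) {r c : ℕ} :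
    (r, c) ∈ (shape α).cells ↔
      ∃ h : r < m, offset α ⟨r, h⟩ ≤ c ∧ c < offset α ⟨r, h⟩ + α ⟨r, h⟩ := by
  simp only [SkewShape.cells, shape, Finset.mem_sdiff, YoungDiagram.mem_cells,
    YoungDiagram.mem_ofRowLens, List.length_ofFn, List.getElem_ofFn]
  constructor
  · rintro ⟨⟨h, h1⟩, h2⟩
    have := hα ⟨r, h⟩
    have h3 : ¬ c < offset α ⟨r, h⟩ := fun h3 => h2 ⟨h, h3⟩
    exact ⟨h, by omega, by omega⟩
  · rintro ⟨h, h1, h2⟩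
    have := hα ⟨r, h⟩
    refine ⟨⟨h, by omega⟩, ?_⟩
    rintro ⟨_, h3⟩
    omega

/-- The last box of a row lies directly below the first box of the row above it. -/
theorem offset_eq_of_succ {α : Fin m → ℕ} (hα : ∀ i, 0 < α i) {i j : Fin m}
    (hij : j.val = i.val + 1) : offset α i + 1 = offset α j + α j := by
  have : Finset.Ioi i = insert j (Finset.Ioi j) := by
    ext k
    simp only [Finset.mem_Ioi, Finset.mem_insert, Fin.lt_def, Fin.ext_iff]
    omega
  have hj := hα j
  rw [offset, this, Finset.sum_insert (by simp), offset]
  omega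

/-- The permutation `α_π = (α_{π⁻¹(1)}, …, α_{π⁻¹(m)})` of the row lengths `α`. -/
def permute (α : Fin m → ℕ) (π : Equiv.Perm (Fin m)) : Fin m → ℕ := fun k => α (π⁻¹ k)

end Ribbon

/-! The coefficient of `s_ν` in the ribbon Schur function of `α` counts the chains `∅ = L 0 ⊆ L 1 ⊆
⋯ ⊆ L m = ν` in which strip `k`, meaning `L (k + 1) / L k`, is a horizontal strip of size `α k`, and
some box of each strip lies strictly above some box of the next (an ascent). The theorem thus
reduces to turning one such chain for `α` into one for the swapped sizes.

Only `L (i + 1)` is changed at first: strip `i` hands `α i - α (i + 1)` of its boxes to strip `i +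
1`. A box of strip `i` is stuck exactly when a box of strip `i + 1` lies directly beneath it, so
there are at most `α (i + 1)` stuck boxes and the transfer is possible. Enlarging strip `i + 1`
cannot hurt its ascent to strip `i + 2`, and a stuck box gives the ascent from `i` to `i + 1`. If
there is freedom, the box of strip `i` that witnesses the ascent from strip `i - 1` is retained too.
If the stuck boxes alone exhaust strip `i`, that ascent may be lost. `StripChain.repair` restores it
by exchanging boxes between adjacent strips, moving the defect towards the start of the chain. The
inequality `α i < α (i - 1) + α (i + 1)` rules out the one obstruction, two consecutive strips lying
in a single row (`StripChain.exists_swap`).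

The expansion itself comes from the identity `r_{(α, b)} h_a = r_{(α, b, a)} + r_{(α, b + a)}` for
ribbon Schur functions. It holds both for fillings of the ribbon and for chains with ascents; the
Pieri rule, proved by growth diagrams, matches the two (`fillingCount_eq_tsum_kostka`). Linear
independence of Schur functions then identifies the support. -/

/-! ### Chains of horizontal strips and sizes of finitely supported sequences -/

/-- `κ / lam` is a horizontal strip, for sequences of row lengths `lam` and `κ`. -/
def Interlace (lam κ : ℕ →₀ ℕ) : Prop := ∀ r, lam r ≤ κ r ∧ κ (r + 1) ≤ lam r

/-- Some box of the strip `κ₁ / κ₀` lies strictly above some box of the strip `κ₂ / κ₁`. -/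
def StripAscent (κ₀ κ₁ κ₂ : ℕ →₀ ℕ) : Prop :=
  ∃ r r', r < r' ∧ κ₀ r < κ₁ r ∧ κ₁ r' < κ₂ r'

/-- A chain of horizontal strips whose sizes are given by `α`. -/
structure StripChain (m : ℕ) (α : ℕ → ℕ) (L : ℕ → ℕ →₀ ℕ) : Prop where
  zero : L 0 = 0
  interlace : ∀ k < m, Interlace (L k) (L (k + 1))
  degree : ∀ k < m, (L (k + 1)).degree = (L k).degree + α k

theorem Finsupp.degree_add_of_eq_off {f g : ℕ →₀ ℕ} (r₀ : ℕ) (h : ∀ r, r ≠ r₀ → f r = g r) :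
    g.degree + f r₀ = f.degree + g r₀ := by
  have : g + Finsupp.single r₀ (f r₀) = f + Finsupp.single r₀ (g r₀) := by
    ext r
    by_cases hr : r = r₀
    · subst hr; simp [add_comm]
    · simp [hr, h r hr]
  simpa using congrArg Finsupp.degree this

theorem Finsupp.exists_lt_of_degree_lt {f g : ℕ →₀ ℕ} (h : f.degree < g.degree) :
    ∃ r, f r < g r := by
  by_contra! hc
  exact absurd (Finsupp.degree_mono (show g ≤ f from hc)) (by omega)

theorem Finsupp.apply_add_degree_le {f g : ℕ →₀ ℕ} (h : f ≤ g) (r : ℕ) :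
    g r + f.degree ≤ f r + g.degree := by
  have : f + Finsupp.single r (g r) ≤ g + Finsupp.single r (f r) := fun q => by
    rcases eq_or_ne q r with rfl | n
    · simp [add_comm]
    · simpa [Finsupp.single_apply, n.symm] using h q
  simpa [add_comm] using Finsupp.degree_mono this

theorem Finsupp.degree_eq_sum_range {f : ℕ →₀ ℕ} {N : ℕ} (h : ∀ r, N ≤ r → f r = 0) :
    f.degree = ∑ r ∈ Finset.range N, f r := by
  rw [Finsupp.degree_apply]
  refine Finset.sum_subset (fun r hr => ?_) (by simp)
  by_contra hc
  exact (Finsupp.mem_support_iff.1 hr) (h r (by simpa using hc))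

theorem Finsupp.exists_forall_ge_eq_zero (f : ℕ →₀ ℕ) : ∃ N, ∀ r, N ≤ r → f r = 0 := by
  refine ⟨f.support.sup id + 1, fun r hr => ?_⟩
  by_contra hc
  have := Finset.le_sup (f := id) (Finsupp.mem_support_iff.2 hc)
  simp only [id] at this
  omega

theorem Finsupp.degree_eq_degree_comapDomain_succ_add (f : ℕ →₀ ℕ) :
    f.degree = (f.comapDomain Nat.succ Nat.succ_injective.injOn).degree + f 0 := by
  obtain ⟨N, hN⟩ := f.exists_forall_ge_eq_zero
  rw [Finsupp.degree_eq_sum_range (N := N + 1) fun r hr => hN r (by omega),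
    Finsupp.degree_eq_sum_range (N := N) fun r hr => by simpa using hN (r + 1) (by omega),
    Finset.sum_range_succ']
  simp

/-- A discrete intermediate value principle: boxes are added one at a time. -/
theorem Finsupp.exists_degree_eq {lo hi : ℕ →₀ ℕ} (hle : lo ≤ hi) {s : ℕ} (h₁ : lo.degree ≤ s)
    (h₂ : s ≤ hi.degree) : ∃ x, lo ≤ x ∧ x ≤ hi ∧ x.degree = s := by
  induction s, h₁ using Nat.le_induction with
  | base => exact ⟨lo, le_rfl, hle, rfl⟩
  | succ s hs ih =>
    obtain ⟨x, h1, h2, h3⟩ := ih (by omega)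
    obtain ⟨r, hr⟩ := Finsupp.exists_lt_of_degree_lt (show x.degree < hi.degree by omega)
    refine ⟨x + Finsupp.single r 1, h1.trans (by simp), fun q => ?_, by simp [h3]⟩
    by_cases hq : q = r
    · subst hq; simp; omega
    · simpa [Finsupp.single_apply, Ne.symm hq] using h2 q

/-! ### Exchanging boxes between adjacent strips -/

/-- Replacing one inner partition of a chain of strips. -/
theorem StripChain.update {m : ℕ} {α β : ℕ → ℕ} {L : ℕ → ℕ →₀ ℕ} (hL : StripChain m α L) {k : ℕ}
    (hk : k + 1 < m) {x : ℕ →₀ ℕ} (h₁ : Interlace (L k) x) (h₂ : Interlace x (L (k + 2)))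
    (hd : x.degree = (L k).degree + β k) (hs : α k + α (k + 1) = β k + β (k + 1))
    (hαβ : ∀ j, j ≠ k → j ≠ k + 1 → α j = β j) :
    StripChain m β (Function.update L (k + 1) x) := by
  refine ⟨by simp [Function.update, hL.zero], fun j hj => ?_, fun j hj => ?_⟩
  · rcases eq_or_ne j k with rfl | h1
    · simpa [Function.update] using h₁
    rcases eq_or_ne j (k + 1) with rfl | h2
    · simpa [Function.update] using h₂
    · simpa [Function.update, h1, h2] using hL.interlace j hj
  · rcases eq_or_ne j k with rfl | h1
    · simpa [Function.update] using hd
    rcases eq_or_ne j (k + 1) with rfl | h2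
    · have e1 := hL.degree k (by omega)
      have e2 := hL.degree (k + 1) hj
      simp [Function.update] at *
      omega
    · simpa [Function.update, h1, h2, hαβ j h1 h2] using hL.degree j hj

/-- Raising one box of the strip `κ / lam` and lowering one of its neighbour: the exchange of
a larger entry in row `r` with a smaller entry in row `r'`. -/
theorem Interlace.exchange {l₀ l₁ l₂ : ℕ →₀ ℕ} (h₁ : Interlace l₀ l₁) (h₂ : Interlace l₁ l₂)
    (hasc : ¬ StripAscent l₀ l₁ l₂) {r r' : ℕ} (hrr : r < r') (hr : l₁ r < l₂ r)
    (hr' : l₀ r' < l₁ r') :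
    ∃ x : ℕ →₀ ℕ, Interlace l₀ x ∧ Interlace x l₂ ∧ x.degree = l₁.degree ∧ x r = l₁ r + 1 ∧
      x r' + 1 = l₁ r' ∧ ∀ q, q ≠ r → q ≠ r' → x q = l₁ q := by
  have hasc' : ∀ q q', q < q' → l₀ q < l₁ q → ¬ l₁ q' < l₂ q' := fun q q' h1 h2 h3 =>
    hasc ⟨q, q', h1, h2, h3⟩
  set x : ℕ →₀ ℕ := (l₁ + Finsupp.single r 1) - Finsupp.single r' 1 with hx
  have xr : x r = l₁ r + 1 := by simp [hx, hrr.ne']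
  have xr' : x r' + 1 = l₁ r' := by simp [hx, hrr.ne]; omega
  have xq : ∀ q, q ≠ r → q ≠ r' → x q = l₁ q := fun q h1 h2 => by
    simp [hx, h1.symm, h2.symm]
  -- Only `x r ≤ l₀ (r - 1)` and `l₂ (r' + 1) ≤ x r'` are at risk. Both follow from the absence of
  -- an ascent between adjacent rows: it forces `l₀ (r - 1) = l₁ (r - 1)` in the first case and `l₁
  -- (r' + 1) = l₂ (r' + 1)` in the second.
  refine ⟨x, fun q => ?_, fun q => ?_, ?_, xr, xr', xq⟩
  · have a1 := h₁ q
    have a2 := h₂ q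
    have a3 := hasc' q (q + 1) (by omega)
    constructor
    · rcases eq_or_ne q r with rfl | n1
      · omega
      rcases eq_or_ne q r' with rfl | n2
      · omega
      · rw [xq q n1 n2]; omega
    · rcases eq_or_ne (q + 1) r with n1 | n1
      · rw [n1, xr]; rw [n1] at a1 a2 a3
        omega
      rcases eq_or_ne (q + 1) r' with n2 | n2
      · rw [n2] at a1; rw [n2]; omega
      · rw [xq _ n1 n2]; omega
  · have a1 := h₁ q
    have a2 := h₂ q
    have a3 := hasc' q (q + 1) (by omega)
    have a4 := h₁ (q + 1)
    constructor
    · rcases eq_or_ne q r with rfl | n1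
      · omega
      rcases eq_or_ne q r' with rfl | n2
      · omega
      · rw [xq q n1 n2]; omega
    · rcases eq_or_ne q r with rfl | n1
      · omega
      rcases eq_or_ne q r' with rfl | n2
      · have := h₂ (q + 1)
        omega
      · rw [xq _ n1 n2]; omega
  · have : x + Finsupp.single r' 1 = l₁ + Finsupp.single r 1 := by
      rw [hx]
      refine tsub_add_cancel_of_le fun q => ?_
      rcases eq_or_ne q r' with rfl | n2
      · simp; omega
      · simp [Finsupp.single_apply, n2.symm]
    simpa using congrArg Finsupp.degree this

/-- A chain of strips in which only the ascent at the strip `k` may be missing can be repaired. -/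
theorem StripChain.repair {m : ℕ} {β : ℕ → ℕ} (hβ : ∀ k < m, 2 ≤ β k) (k : ℕ) (hk : k + 1 < m) :
    ∀ {L : ℕ → ℕ →₀ ℕ}, StripChain m β L →
    (∀ j, j + 1 < m → j + 1 ≠ k → StripAscent (L j) (L (j + 1)) (L (j + 2))) →
    (∀ r, ∃ r₁ r₂, r₁ < r₂ ∧ L k r₁ + (if r₁ = r then 1 else 0) < L (k + 1) r₁ ∧
      L (k + 1) r₂ < L (k + 2) r₂) →
    (∀ r₀, (∀ r, r ≠ r₀ → L k r = L (k + 1) r) → 1 ≤ k →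
      L k r₀ < L k (r₀ + 1) + β (k - 1)) →
    ∃ L', StripChain m β L' ∧
      (∀ j, j + 1 < m → StripAscent (L' j) (L' (j + 1)) (L' (j + 2))) ∧ L' m = L m := by
  -- The third hypothesis says that the ascent from strip `k` to strip `k + 1` survives the loss of
  -- any one box of strip `k`. The fourth prevents strips `k - 1` and `k` from lying in one common
  -- row, where no exchange could help.
  induction k with
  | zero => exact fun {L} hL hasc _ _ => ⟨L, hL, fun j hj => hasc j hj (by omega), rfl⟩
  | succ k ih =>
    intro L hL hasc ha hb
    by_cases hgood : StripAscent (L k) (L (k + 1)) (L (k + 2))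
    · refine ⟨L, hL, fun j hj => ?_, rfl⟩
      rcases eq_or_ne j k with rfl | hne
      · exact hgood
      · exact hasc j hj (by omega)
    have hI₁ := hL.interlace k (by omega)
    have hI₂ := hL.interlace (k + 1) (by omega)
    have hd₁ := hL.degree k (by omega)
    have hd₂ := hL.degree (k + 1) (by omega)
    have hβk := hβ k (by omega)
    have hβk' := hβ (k + 1) (by omega)
    have hng : ∀ q q', q < q' → L k q < L (k + 1) q → ¬ L (k + 1) q' < L (k + 2) q' :=
      fun q q' h1 h2 h3 => hgood ⟨q, q', h1, h2, h3⟩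
    -- the effect of an exchange
    have swap : ∀ r r', r < r' → L (k + 1) r < L (k + 2) r → L k r' < L (k + 1) r' →
        ∃ L', StripChain m β L' ∧ L' m = L m ∧ (∀ j, j ≠ k + 1 → L' j = L j) ∧
          (∀ j, j + 1 < m → j + 1 ≠ k → StripAscent (L' j) (L' (j + 1)) (L' (j + 2))) ∧
          L' (k + 1) r = L (k + 1) r + 1 ∧ L' (k + 1) r' + 1 = L (k + 1) r' ∧
          ∀ q, q ≠ r → q ≠ r' → L' (k + 1) q = L (k + 1) q := by
      intro r r' hrr hr hr'
      obtain ⟨x, x1, x2, xd, xr, xr', xq⟩ := hI₁.exchange hI₂ hgood hrr hr hr'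
      have e0 : ∀ j, j ≠ k + 1 → Function.update L (k + 1) x j = L j := fun j hj => by
        simp [Function.update, hj]
      have e1 : Function.update L (k + 1) x (k + 1) = x := by simp
      refine ⟨Function.update L (k + 1) x,
        hL.update (by omega) x1 x2 (by omega) rfl (fun _ _ _ => rfl), e0 _ (by omega), e0,
        fun j hj hjk => ?_, by rw [e1, xr], by rw [e1, xr'], by rw [e1]; exact xq⟩
      rcases eq_or_ne j k with rfl | n1
      · rw [e1, e0 j (by omega), e0 (j + 2) (by omega)]
        refine ⟨r, r', hrr, by have := (hI₁ r).1; omega, ?_⟩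
        have := (hI₂ r').1
        simp only [add_assoc, Nat.reduceAdd] at this
        omega
      rcases eq_or_ne j (k + 1) with rfl | n2
      · rw [e1, e0 (k + 1 + 1) (by omega), e0 (k + 1 + 2) (by omega)]
        obtain ⟨r₁, r₂, h1, h2, h3⟩ := ha r
        refine ⟨r₁, r₂, h1, ?_, h3⟩
        rcases eq_or_ne r₁ r with rfl | n3
        · simp at h2; omega
        rcases eq_or_ne r₁ r' with rfl | n4
        · omega
        · rw [xq _ n3 n4]; omega
      · rw [e0 j n2, e0 (j + 1) (by omega), e0 (j + 2) (by omega)]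
        exact hasc j hj (by omega)
    by_cases hex : ∃ r r', r < r' ∧ L (k + 1) r < L (k + 2) r ∧ L k r' < L (k + 1) r'
    swap
    -- Neither strip has a box strictly above one of the other, so both lie in one row `q`. Then `L
    -- (k + 1) q = L k q + β k`, while `L (k + 1) (q + 1) ≤ L k q` because strip `k` is horizontal;
    -- this contradicts `hb`.
    · exfalso
      push Not at hex
      obtain ⟨q, hq⟩ :=
        Finsupp.exists_lt_of_degree_lt (show (L k).degree < (L (k + 1)).degree by omega)
      have hone : ∀ r, r ≠ q → L (k + 1) r = L (k + 2) r := fun r hr => by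
        have b1 : L (k + 1) r ≤ L (k + 2) r := (hI₂ r).1
        by_contra hne
        rcases lt_or_gt_of_ne hr with h | h
        · have := hex r q h (by omega); omega
        · exact hng q r h hq (by omega)
      obtain ⟨p, hp⟩ := Finsupp.exists_lt_of_degree_lt
        (show (L (k + 1)).degree < (L (k + 2)).degree from by
          have : (L (k + 2)).degree = _ := hd₂
          omega)
      have hpq : p = q := by
        by_contra hne
        have := hone p hne; omega
      have hone' : ∀ r, r ≠ q → L k r = L (k + 1) r := fun r hr => by
        have b1 := (hI₁ r).1
        by_contra hne
        rcases lt_or_gt_of_ne hr with h | h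
        · exact hng r q h (by omega) (hpq ▸ hp)
        · have := hex q r h (hpq ▸ hp); omega
      have h1 := hb q hone (by omega)
      have h2 := Finsupp.degree_add_of_eq_off q hone'
      have h3 := (hI₁ q).2
      simp only [Nat.add_sub_cancel] at h1
      omega
    -- When the defect is at the first two strips, there is no earlier ascent that an exchange could
    -- destroy.
    rcases k with _ | k
    · obtain ⟨r, r', h1, h2, h3⟩ := hex
      obtain ⟨L', c1, c2, -, c3, -⟩ := swap r r' h1 h2 h3
      exact ⟨L', c1, fun j hj => c3 j hj (by omega), c2⟩
    obtain ⟨s₁, s₂, hs, hs₁, hs₂⟩ := hasc k (by omega) (by omega)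
    -- The exchange removes a box of the lower-indexed strip from row `r'`. The preceding ascent,
    -- witnessed by `s₁ < s₂`, is safe unless this is the only box of that strip in row `s₂`.
    by_cases hex' : ∃ r r', r < r' ∧ L (k + 2) r < L (k + 3) r ∧ L (k + 1) r' < L (k + 2) r' ∧
        (r' ≠ s₂ ∨ L (k + 1) s₂ + 2 ≤ L (k + 2) s₂)
    · obtain ⟨r, r', h1, h2, h3, h4⟩ := hex'
      obtain ⟨L', c1, c2, c3, c4, c5, c6, c7⟩ := swap r r' h1 h2 h3
      refine ⟨L', c1, fun j hj => ?_, c2⟩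
      rcases eq_or_ne j k with rfl | hne
      · refine ⟨s₁, s₂, hs, ?_, ?_⟩
        · rw [c3 _ (by omega), c3 _ (by omega)]; exact hs₁
        · rw [c3 _ (by omega)]
          change _ < L' (j + 1 + 1) s₂
          rcases eq_or_ne s₂ r' with rfl | n1
          · simp only [add_assoc, Nat.reduceAdd] at *
            simp at h4
            omega
          rcases eq_or_ne s₂ r with rfl | n2
          · rw [c5]
            exact hs₂.trans (by simp)
          · rw [c7 _ n2 n1]
            exact hs₂
      · exact c4 j hj (by omega)
    -- Every available exchange now uses up the sole box in the witness row `r'`. As the strip has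
    -- at least two boxes, it has one in another row. This row must be `r₀`, and the following strip
    -- must lie entirely in `r₀`. After the exchange the strip is concentrated in row `r₀`, and the
    -- possible defect has moved one place earlier.
    · push Not at hex'
      obtain ⟨r₀, r', h1, h2, h3⟩ := hex
      obtain ⟨rfl, h4⟩ := hex' r₀ r' h1 h2 h3
      have hrow : ∀ q, q ≠ r' → L (k + 1) q < L (k + 2) q → q = r₀ ∧
          ∀ r, r ≠ q → L (k + 2) r = L (k + 3) r := by
        intro q hq1 hq2
        have hone : ∀ r, r ≠ q → L (k + 2) r = L (k + 3) r := fun r hr => by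
          have b1 : L (k + 2) r ≤ L (k + 3) r := (hI₂ r).1
          by_contra hne
          rcases lt_or_gt_of_ne hr with h | h
          · exact hq1 (hex' r q h (by omega) hq2).1
          · exact hng q r h hq2 (lt_of_le_of_ne b1 hne)
        refine ⟨?_, hone⟩
        by_contra hne
        have b2 : L (k + 2) r₀ < L (k + 3) r₀ := h2
        have := hone r₀ (Ne.symm hne)
        omega
      obtain ⟨L', c1, c2, c3, c4, c5, c6, c7⟩ := swap r₀ r' h1 h2 h3
      simp only [add_assoc, Nat.reduceAdd] at c5 c6 c7 h3 h4 c3 hd₁ hβk h2 hI₂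
      have hoff : ∀ r, r ≠ r₀ → L' (k + 1) r = L' (k + 2) r := fun r hr => by
        rw [c3 _ (by omega)]
        rcases eq_or_ne r r' with rfl | n1
        · omega
        · rw [c7 _ hr n1]
          have b1 : L (k + 1) r ≤ L (k + 2) r := (hI₁ r).1
          by_contra hne
          exact hr (hrow r n1 (by omega)).1
      have hdeg := Finsupp.degree_add_of_eq_off r₀ hoff
      have hd' : (L' (k + 2)).degree = _ := c1.degree (k + 1) (by omega)
      have hfirst : ∃ q, q ≠ r' ∧ L (k + 1) q < L (k + 2) q := by
        by_contra! hc
        have := Finsupp.degree_add_of_eq_off r' (f := L (k + 1)) (g := L (k + 2)) fun q hq =>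
          le_antisymm (hI₁ q).1 (hc q hq)
        omega
      obtain ⟨q, hq1, hq2⟩ := hfirst
      obtain ⟨rfl, hq3⟩ := hrow q hq1 hq2
      have e1 : L' (k + 1) = L (k + 1) := c3 _ (by omega)
      rw [e1] at hdeg hd'
      -- The new strip has at least two boxes in row `q`, and the next strip has acquired one in row
      -- `r'` below, so their ascent survives the loss of a box.
      obtain ⟨L'', d1, d2, d3⟩ := ih (by omega) c1 c4 (fun r => ⟨q, r', h1, by
          change L' (k + 1) q + _ < L' (k + 2) q
          rw [e1]
          split_ifs <;> omega, by
          change L' (k + 2) r' < L' (k + 3) r'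
          rw [c3 (k + 3) (by omega)]
          have : L (k + 2) r' ≤ L (k + 3) r' := (hI₂ r').1
          omega⟩) (fun r₁ hr₁ _ => by
          have hr : r₁ = q := by
            by_contra hne
            have : L' (k + 1) q = L' (k + 2) q := hr₁ q (Ne.symm hne)
            rw [e1] at this
            omega
          subst hr
          rw [e1]
          -- Before the exchange row `r₁` of the strip had `β (k + 1) - 1` boxes and row `r₁ + 1` at
          -- most one. So `f1` and `f2` give `L (k + 1) r₁ < L (k + 1) (r₁ + 1) + 2`, and `2 ≤ β k`
          -- finishes.
          have f1 : L (k + 2) r₁ < L (k + 2) (r₁ + 1) + β (k + 1) :=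
            hb r₁ (fun r hr => hq3 r hr) (by omega)
          have f2 : L (k + 2) (r₁ + 1) ≤ L (k + 1) (r₁ + 1) + 1 := by
            rcases eq_or_ne (r₁ + 1) r' with n1 | n1
            · rw [n1]; omega
            · have := hoff (r₁ + 1) (by omega)
              rw [e1, c7 _ (by omega) n1] at this
              omega
          have f3 := hβ k (by omega)
          simp only [Nat.add_sub_cancel]
          omega)
      exact ⟨L'', d1, d2, d3.trans c2⟩

/-! ### Swapping the sizes of two adjacent strips -/

/-- The replacement for `L (i + 1)` is sought between `lo`, which contains just the stuck boxes of
strip `i`, and `L (i + 1)`. Whether `lo` already has the prescribed size decides between forced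
repair and free choice. -/
theorem StripChain.exists_swap {m : ℕ} {α : ℕ → ℕ} (hα : ∀ k < m, 2 ≤ α k) {i : ℕ}
    (hi : i + 1 < m) (hgt : α (i + 1) < α i) (htri : 1 ≤ i → α i < α (i - 1) + α (i + 1))
    {L : ℕ → ℕ →₀ ℕ} (hL : StripChain m α L)
    (hasc : ∀ j, j + 1 < m → StripAscent (L j) (L (j + 1)) (L (j + 2))) :
    ∃ L', StripChain m (α ∘ Equiv.swap i (i + 1)) L' ∧
      (∀ j, j + 1 < m → StripAscent (L' j) (L' (j + 1)) (L' (j + 2))) ∧ L' m = L m := by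
  have hI₁ := hL.interlace i (by omega)
  have hI₂ : Interlace (L (i + 1)) (L (i + 2)) := hL.interlace (i + 1) hi
  have hd₁ := hL.degree i (by omega)
  have hd₂ : (L (i + 2)).degree = (L (i + 1)).degree + α (i + 1) := hL.degree (i + 1) hi
  have hp := hα (i + 1) hi
  set β := α ∘ Equiv.swap i (i + 1) with hβ
  have β₀ : β i = α (i + 1) := by simp [hβ]
  have β₁ : β (i + 1) = α i := by simp [hβ]
  have βj : ∀ j, j ≠ i → j ≠ i + 1 → α j = β j := fun j h1 h2 => by
    simp [hβ, Equiv.swap_apply_of_ne_of_ne h1 h2]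
  have hβ2 : ∀ k < m, 2 ≤ β k := fun k hk => by
    rcases eq_or_ne k i with rfl | h1
    · omega
    rcases eq_or_ne k (i + 1) with rfl | h2
    · have := hα i (by omega); omega
    · rw [← βj k h1 h2]; exact hα k hk
  -- the part of the strip that cannot be given up
  set sh : (ℕ →₀ ℕ) → (ℕ →₀ ℕ) := fun f => f.comapDomain Nat.succ Nat.succ_injective.injOn with hsh
  have sh_apply : ∀ f r, sh f r = f (r + 1) := fun f r => by simp [hsh]
  have sh_deg : ∀ f : ℕ →₀ ℕ, f.degree = (sh f).degree + f 0 :=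
    Finsupp.degree_eq_degree_comapDomain_succ_add
  set lo : ℕ →₀ ℕ := L i ⊔ sh (L (i + 2)) with hlo
  have lo_apply : ∀ r, lo r = max (L i r) (L (i + 2) (r + 1)) := fun r => by
    simp [hlo, Finsupp.sup_apply, sh_apply]
  have hlo_le : lo ≤ L (i + 1) := fun r => by
    rw [lo_apply]; exact max_le (hI₁ r).1 (hI₂ r).2
  -- Stuck boxes inject into strip `i + 1` by moving one row down. In terms of sizes this is the
  -- inequality `h1`, with `sh` deleting the top row.
  have hlo_deg : lo.degree ≤ (L i).degree + α (i + 1) := by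
    have h1 : lo + sh (L (i + 1)) ≤ L i + sh (L (i + 2)) := fun r => by
      have a1 := hI₁ r
      have a2 := hI₂ (r + 1)
      simp only [Finsupp.add_apply, lo_apply, sh_apply]
      omega
    have h2 := Finsupp.degree_mono h1
    simp only [map_add] at h2
    have h3 := sh_deg (L (i + 1))
    have h4 := sh_deg (L (i + 2))
    have h5 := (hI₂ 0).1
    omega
  -- any choice above it gives a chain
  have upd : ∀ x : ℕ →₀ ℕ, lo ≤ x → x ≤ L (i + 1) → x.degree = (L i).degree + α (i + 1) →
      StripChain m β (Function.update L (i + 1) x) := fun x h1 h2 h3 => by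
    have h1' : ∀ r, max (L i r) (L (i + 2) (r + 1)) ≤ x r := fun r => by
      rw [← lo_apply]; exact h1 r
    refine hL.update hi (fun r => ?_) (fun r => ?_) (by omega) (by omega) βj
    · have := h1' r; have := h2 (r + 1); have := hI₁ r; omega
    · have := h1' r; have := h2 r; have := hI₂ r; omega
  have e0 : ∀ x j, j ≠ i + 1 → Function.update L (i + 1) x j = L j := fun x j hj => by
    simp [Function.update, hj]
  have e1 : ∀ x, Function.update L (i + 1) x (i + 1) = x := fun x => by simp
  have asc_of : ∀ x : ℕ →₀ ℕ, x ≤ L (i + 1) → StripAscent (L i) x (L (i + 2)) →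
      ∀ j, j + 1 < m → j + 1 ≠ i →
      StripAscent (Function.update L (i + 1) x j) (Function.update L (i + 1) x (j + 1))
        (Function.update L (i + 1) x (j + 2)) := by
    intro x hx h j hj hji
    rcases eq_or_ne j i with rfl | n1
    · rw [e1, e0 _ _ (by omega), e0 _ _ (by omega)]; exact h
    rcases eq_or_ne j (i + 1) with rfl | n2
    · rw [e1, e0 _ _ (by omega), e0 _ _ (by omega)]
      obtain ⟨r, r', h1, h2, h3⟩ := hasc (i + 1) hj
      exact ⟨r, r', h1, (hx r).trans_lt h2, h3⟩
    · rw [e0 _ _ n2, e0 _ _ (by omega), e0 _ _ (by omega)]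
      exact hasc j hj
  -- boxes that are stuck give ascents
  have pair : ∀ x : ℕ →₀ ℕ, x ≤ L (i + 1) → ∀ r, L i r < L (i + 2) (r + 1) →
      x (r + 1) < L (i + 2) (r + 1) := fun x hx r hr =>
    ((hx (r + 1)).trans (hI₁ r).2).trans_lt hr
  obtain ⟨r₂, r₃, h23, hr₂, hr₃⟩ := hasc i hi
  rcases hlo_deg.eq_or_lt with heq | hlt
  · -- no choice
    have hstuck : ∀ r, L i r < lo r → L i r < L (i + 2) (r + 1) ∧ lo r = L (i + 2) (r + 1) :=
      fun r hr => by rw [lo_apply] at hr ⊢; omega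
    have hLlo : ∀ r, L i r ≤ lo r := fun r => by rw [lo_apply]; omega
    have hasc₁ : StripAscent (L i) lo (L (i + 2)) := by
      obtain ⟨r, hr⟩ := Finsupp.exists_lt_of_degree_lt (show (L i).degree < lo.degree by omega)
      exact ⟨r, r + 1, by omega, hr, pair lo hlo_le r (hstuck r hr).1⟩
    obtain ⟨L', c1, c2, c3⟩ := StripChain.repair hβ2 i hi (upd lo le_rfl hlo_le heq)
      (asc_of lo hlo_le hasc₁)
      (fun r => by
        rw [e1, e0 _ _ (by omega), e0 _ _ (by omega)]
        have : ∃ r₁, L i r₁ + (if r₁ = r then 1 else 0) < lo r₁ := by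
          by_contra! hc
          have h1 := Finsupp.degree_add_of_eq_off (f := L i) (g := lo) r fun q hq => by
            have a1 := hc q
            have a2 := hLlo q
            simp [hq] at a1
            omega
          have h2 := hc r
          simp at h2
          omega
        obtain ⟨r₁, hr₁⟩ := this
        exact ⟨r₁, r₁ + 1, by omega, hr₁, pair lo hlo_le r₁ (hstuck r₁ (by omega)).1⟩)
      -- If all `α (i + 1)` stuck boxes are in row `r₀`, then `L i r₀ + α (i + 1) = L (i + 2) (r₀ +
      -- 1)`. The right side is at most `L i (r₀ + 1) + α i`, since the new strip `i + 1` has `α i`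
      -- boxes. The triangle inequality now yields the last hypothesis of `repair`.
      (fun r₀ hr₀ hpos => by
        rw [e1, e0 _ _ (by omega)] at hr₀
        rw [e0 _ _ (by omega), ← βj (i - 1) (by omega) (by omega)]
        have h1 := Finsupp.degree_add_of_eq_off r₀ hr₀
        have h2 := (hstuck r₀ (by omega)).2
        have h3 := hr₀ (r₀ + 1) (by omega)
        have h4 := htri hpos
        have h5 : L (i + 2) (r₀ + 1) + lo.degree ≤ lo (r₀ + 1) + (L (i + 2)).degree := by
          rw [add_comm (lo _)]
          have := Finsupp.apply_add_degree_le (show lo ≤ L (i + 2) from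
            hlo_le.trans fun r => (hI₂ r).1) (r₀ + 1)
          omega
        omega)
    exact ⟨L', c1, c2, by rw [c3, e0 _ _ (by omega)]⟩
  · -- keep a box in a lowest row
    obtain ⟨r₁, hr₁, hr₁'⟩ : ∃ r₁, L i r₁ < L (i + 1) r₁ ∧
        (1 ≤ i → ∃ r, r < r₁ ∧ L (i - 1) r < L i r) := by
      rcases Nat.eq_zero_or_pos i with rfl | hpos
      · exact ⟨r₂, hr₂, by simp⟩
      · obtain ⟨r, r', h1, h2, h3⟩ := hasc (i - 1) (by omega)
        rw [show i - 1 + 1 = i by omega, show i - 1 + 2 = i + 1 by omega] at *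
        exact ⟨r', h3, fun _ => ⟨r, h1, h2⟩⟩
    have fin : ∀ x : ℕ →₀ ℕ, lo ≤ x → x ≤ L (i + 1) → x.degree = (L i).degree + α (i + 1) →
        L i r₁ < x r₁ → StripAscent (L i) x (L (i + 2)) →
        ∃ L', StripChain m β L' ∧
          (∀ j, j + 1 < m → StripAscent (L' j) (L' (j + 1)) (L' (j + 2))) ∧ L' m = L m := by
      intro x h1 h2 h3 h4 h5
      refine ⟨_, upd x h1 h2 h3, fun j hj => ?_, e0 _ _ (by omega)⟩
      by_cases hji : j + 1 = i
      · subst hji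
        rw [e0 _ _ (by omega), e0 _ _ (by omega), e1]
        obtain ⟨r, h6, h7⟩ := hr₁' (by omega)
        exact ⟨r, r₁, h6, h7, h4⟩
      · exact asc_of x h2 h5 j hj hji
    have single_le : ∀ r, L i r < L (i + 1) r → L i + Finsupp.single r 1 ≤ L (i + 1) :=
      fun r hr q => by
        rcases eq_or_ne q r with rfl | n
        · simpa using hr
        · simpa [Finsupp.single_apply, n.symm] using (hI₁ q).1
    -- With a stuck box the ascent to strip `i + 1` is automatic, and strict inequality in `hlt`
    -- leaves room for the box in row `r₁`. With none, `lo = L i`, and `2 ≤ α (i + 1)` leaves room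
    -- for boxes in both rows `r₁` and `r₂`, one for each ascent.
    by_cases hpair : ∃ r, L i r < L (i + 2) (r + 1)
    · obtain ⟨r, hr⟩ := hpair
      obtain ⟨x, x1, x2, x3⟩ := Finsupp.exists_degree_eq (s := (L i).degree + α (i + 1))
        (sup_le hlo_le (single_le r₁ hr₁)) (by
          refine (Finsupp.degree_mono (show _ ≤ lo + Finsupp.single r₁ 1 from
            sup_le (by simp) (add_le_add_left (show L i ≤ lo from le_sup_left) _))).trans ?_
          simpa using hlt) (by omega)
      have x4 : lo ≤ x := le_sup_left.trans x1
      refine fin x x4 x2 x3 ?_ ⟨r, r + 1, by omega, ?_, pair x x2 r hr⟩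
      · have := (le_sup_right.trans x1) r₁
        simpa using this
      · have := x4 r
        rw [lo_apply] at this
        omega
    · push Not at hpair
      have hlo_eq : lo = L i := by ext r; rw [lo_apply]; have := hpair r; omega
      obtain ⟨x, x1, x2, x3⟩ := Finsupp.exists_degree_eq (s := (L i).degree + α (i + 1))
        (sup_le (single_le r₁ hr₁) (single_le r₂ hr₂)) (by
          refine (Finsupp.degree_mono (show _ ≤ L i + Finsupp.single r₁ 1 + Finsupp.single r₂ 1 from
            sup_le (by simp) (by rw [add_right_comm]; simp))).trans ?_
          simp; omega) (by omega)
      have y1 := (le_sup_left.trans x1) r₁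
      have y2 := (le_sup_right.trans x1) r₂
      refine fin x ?_ x2 x3 (by simpa using y1) ⟨r₂, r₃, h23, by simpa using y2, ?_⟩
      · rw [hlo_eq]
        exact (show L i ≤ L i + Finsupp.single r₁ 1 by simp).trans (le_sup_left.trans x1)
      · exact (x2 r₃).trans_lt hr₃

/-! ### Counting by sums of indicators, and the growth rule -/

open scoped ENNReal

/-- The indicator of a proposition, as an extended nonnegative real. -/
noncomputable def ind (p : Prop) : ℝ≥0∞ := open Classical in if p then 1 else 0

theorem ind_of {p : Prop} (h : p) : ind p = 1 := by simp [ind, h]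

theorem ind_of_not {p : Prop} (h : ¬ p) : ind p = 0 := by simp [ind, h]

theorem ind_and (p q : Prop) : ind (p ∧ q) = ind p * ind q := by
  by_cases hp : p <;> by_cases hq : q <;> simp [ind, hp, hq]

theorem ind_mul_congr {p : Prop} {x y : ℝ≥0∞} (h : p → x = y) : ind p * x = ind p * y := by
  by_cases hp : p
  · rw [h hp]
  · simp [ind_of_not hp]

theorem tsum_ind_eq_mul {X : Type*} (x : X) (F : X → ℝ≥0∞) : ∑' y, ind (y = x) * F y = F x := by
  rw [tsum_eq_single x fun y hy => by simp [ind_of_not hy]]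
  simp [ind_of]

theorem tsum_ind_mul {X : Type*} (p : X → Prop) (F : X → ℝ≥0∞) :
    ∑' x, ind (p x) * F x = ∑' x : {x // p x}, F x := by
  classical
  rw [show (∑' x : {x // p x}, F x) = ∑' x, ({x | p x} : Set X).indicator F x from
    tsum_subtype {x | p x} F]
  refine tsum_congr fun x => ?_
  by_cases h : p x <;> simp [ind, h]

theorem tsum_ind_mul_congr {X Y : Type*} {p : X → Prop} {q : Y → Prop} (e : X → Y)
    (e' : Y → X) (h₁ : ∀ x, p x → q (e x) ∧ e' (e x) = x) (h₂ : ∀ y, q y → p (e' y) ∧ e (e' y) = y)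
    (F : Y → ℝ≥0∞) :
    ∑' x, ind (p x) * F (e x) = ∑' y, ind (q y) * F y := by
  rw [tsum_ind_mul, tsum_ind_mul]
  let E : {x // p x} ≃ {y // q y} :=
    { toFun := fun x => ⟨e x, (h₁ x x.2).1⟩
      invFun := fun y => ⟨e' y, (h₂ y y.2).1⟩
      left_inv := fun x => Subtype.ext (h₁ x x.2).2
      right_inv := fun y => Subtype.ext (h₂ y y.2).2 }
  exact E.tsum_eq fun y => F y

theorem tsum_ind_congr {X Y : Type*} {p : X → Prop} {q : Y → Prop} (e : X → Y)
    (e' : Y → X) (h₁ : ∀ x, p x → q (e x) ∧ e' (e x) = x)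
    (h₂ : ∀ y, q y → p (e' y) ∧ e (e' y) = y) :
    ∑' x, ind (p x) = ∑' y, ind (q y) := by
  simpa using tsum_ind_mul_congr e e' h₁ h₂ fun _ => 1

theorem tsum_rotate {X Y Z : Type*} (F : X → Y → Z → ℝ≥0∞) :
    ∑' x, ∑' y, ∑' z, F x y z = ∑' z, ∑' x, ∑' y, F x y z :=
  (tsum_congr fun _ => ENNReal.tsum_comm).trans ENNReal.tsum_comm

theorem tsum_fin_succ {X : Type*} (n : ℕ) (F : (Fin (n + 1) → X) → ℝ≥0∞) :
    ∑' f, F f = ∑' f : Fin n → X, ∑' x : X, F (Fin.snoc f x) := by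
  rw [← (Fin.snocEquiv fun _ => X).tsum_eq F, ENNReal.tsum_prod', ENNReal.tsum_comm]
  rfl

/-- The local rule of growth diagrams. -/
theorem tsum_interlace_comm (l ρ : ℕ →₀ ℕ) (a c : ℕ) :
    ∑' κ : ℕ →₀ ℕ, ind ((Interlace l κ ∧ Interlace ρ κ) ∧
      κ.degree = l.degree + a ∧ κ.degree = ρ.degree + c) =
    ∑' x : ℕ × (ℕ →₀ ℕ), ind ((Interlace x.2 l ∧ Interlace x.2 ρ) ∧
      l.degree + x.1 = x.2.degree + c ∧ ρ.degree + x.1 = x.2.degree + a) := by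
  set sh : (ℕ →₀ ℕ) → (ℕ →₀ ℕ) := fun f => f.comapDomain Nat.succ Nat.succ_injective.injOn with hsh
  have sh_apply : ∀ f r, sh f r = f (r + 1) := fun f r => by simp [hsh]
  have sh_deg : ∀ f : ℕ →₀ ℕ, f.degree = (sh f).degree + f 0 :=
    Finsupp.degree_eq_degree_comapDomain_succ_add
  -- Both `κ (r + 1)` and `μ r` range over the interval from `max (l (r + 1)) (ρ (r + 1))` to `min
  -- (l r) (ρ r)`, and `R` reflects it. The top row of `κ` has no upper bound; its excess over `max
  -- (l 0) (ρ 0)` is the extra number `b`. The map `co` restores this row.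
  set R : (ℕ →₀ ℕ) → (ℕ →₀ ℕ) := fun x => (sh (l ⊔ ρ) + (l ⊓ ρ)) - x with hR
  have R_apply : ∀ x r, R x r = max (l (r + 1)) (ρ (r + 1)) + min (l r) (ρ r) - x r := fun x r => by
    simp [hR, sh_apply, Finsupp.sup_apply, Finsupp.inf_apply]
  set co : ℕ → (ℕ →₀ ℕ) → (ℕ →₀ ℕ) := fun b x => x.mapDomain Nat.succ + Finsupp.single 0 b with hco
  have co_zero : ∀ b x, co b x 0 = b := fun b x => by
    simp [hco, Finsupp.mapDomain_of_notMem_range]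
  have co_succ : ∀ b x r, co b x (r + 1) = x r := fun b x r => by
    simp [hco, Finsupp.mapDomain_apply Nat.succ_injective x r]
  have hdeg : ∀ κ μ : ℕ →₀ ℕ,
      (∀ r, κ (r + 1) + μ r = max (l (r + 1)) (ρ (r + 1)) + min (l r) (ρ r)) →
      κ.degree + μ.degree + max (l 0) (ρ 0) = l.degree + ρ.degree + κ 0 := by
    intro κ μ h
    have h1 : sh κ + μ = sh (l ⊔ ρ) + (l ⊓ ρ) := by
      ext r; simpa [sh_apply, Finsupp.sup_apply, Finsupp.inf_apply] using h r
    have h2 : (l ⊔ ρ) + (l ⊓ ρ) = l + ρ := by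
      ext r; simp [Finsupp.sup_apply, Finsupp.inf_apply, max_add_min]
    have h3 := congrArg Finsupp.degree h1
    have h4 := congrArg Finsupp.degree h2
    have h5 := sh_deg κ
    have h6 := sh_deg (l ⊔ ρ)
    simp only [map_add, Finsupp.sup_apply] at h3 h4 h6
    omega
  refine tsum_ind_congr (fun κ => (κ 0 - max (l 0) (ρ 0), R (sh κ)))
    (fun x => co (max (l 0) (ρ 0) + x.1) (R x.2)) ?_ ?_
  · rintro κ ⟨⟨h1, h2⟩, h3, h4⟩
    have hd := hdeg κ (R (sh κ)) fun r => by
      rw [R_apply, sh_apply]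
      have := h1 r; have := h2 r
      omega
    have h10 := h1 0
    have h20 := h2 0
    refine ⟨⟨⟨fun r => ?_, fun r => ?_⟩, ?_, ?_⟩, ?_⟩
    · have := h1 r; have := h2 r; have := h1 (r + 1); have := h2 (r + 1)
      simp only [R_apply, sh_apply]; omega
    · have := h1 r; have := h2 r; have := h1 (r + 1); have := h2 (r + 1)
      simp only [R_apply, sh_apply]; omega
    · simp only; omega
    · simp only; omega
    · ext r
      rcases r with _ | r
      · rw [co_zero]; simp only; omega
      · rw [co_succ, R_apply, R_apply, sh_apply]
        have := h1 r; have := h2 r; have := h1 (r + 1); have := h2 (r + 1)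
        omega
  · rintro ⟨b, μ⟩ ⟨⟨h1, h2⟩, h3, h4⟩
    simp only at h1 h2 h3 h4
    have hd := hdeg (co (max (l 0) (ρ 0) + b) (R μ)) μ fun r => by
      rw [co_succ, R_apply]
      have := h1 r; have := h2 r
      omega
    rw [co_zero] at hd
    refine ⟨⟨⟨fun r => ?_, fun r => ?_⟩, ?_, ?_⟩, ?_⟩
    · rcases r with _ | r
      · have := h1 0; have := h2 0
        simp only [co_zero, co_succ, R_apply]; omega
      · have := h1 r; have := h2 r; have := h1 (r + 1); have := h2 (r + 1)
        simp only [co_succ, R_apply]; omega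
    · rcases r with _ | r
      · have := h1 0; have := h2 0
        simp only [co_zero, co_succ, R_apply]; omega
      · have := h1 r; have := h2 r; have := h1 (r + 1); have := h2 (r + 1)
        simp only [co_succ, R_apply]; omega
    · simp only; omega
    · simp only; omega
    · refine Prod.ext ?_ ?_
      · simp only [co_zero]; omega
      · ext r
        simp only [R_apply, sh_apply, co_succ]
        have := h1 r; have := h2 r
        omega

/-! ### Fillings, Kostka numbers and the Pieri rule -/

/-- A sequence of row contents whose sizes are `α`, each of which is compatible by `P` with the
sum of those before it and by `Q` with its predecessor. -/
def IsFilling (P Q : (ℕ →₀ ℕ) → (ℕ →₀ ℕ) → Prop) {m : ℕ} (α : Fin m → ℕ)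
    (f : Fin m → ℕ →₀ ℕ) : Prop :=
  (∀ k, (f k).degree = α k) ∧ (∀ k, P (∑ j ∈ Finset.Iio k, f j) (f k)) ∧
    ∀ k k' : Fin m, k'.val = k.val + 1 → Q (f k) (f k')

theorem isFilling_snoc {P Q : (ℕ →₀ ℕ) → (ℕ →₀ ℕ) → Prop} {m : ℕ} (α : Fin m → ℕ) (a : ℕ)
    (f : Fin m → ℕ →₀ ℕ) (g : ℕ →₀ ℕ) :
    IsFilling P Q (Fin.snoc α a : Fin (m + 1) → ℕ) (Fin.snoc f g : Fin (m + 1) → ℕ →₀ ℕ) ↔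
      IsFilling P Q α f ∧ g.degree = a ∧ P (∑ k, f k) g ∧ ∀ k, k.val + 1 = m → Q (f k) g := by
  have h1 : ∀ k : Fin m, ∑ j ∈ Finset.Iio k.castSucc, (Fin.snoc f g : Fin (m + 1) → ℕ →₀ ℕ) j =
      ∑ j ∈ Finset.Iio k, f j := fun k => by
    rw [Fin.Iio_castSucc, Finset.sum_map]
    simp
  have h2 : ∑ j ∈ Finset.Iio (Fin.last m), (Fin.snoc f g : Fin (m + 1) → ℕ →₀ ℕ) j =
      ∑ j, f j := by
    rw [Fin.Iio_last_eq_map, Finset.sum_map]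
    simp
  simp only [IsFilling, Fin.forall_fin_succ', Fin.snoc_castSucc, Fin.snoc_last, h1, h2,
    Fin.val_castSucc, Fin.val_last]
  constructor
  · rintro ⟨⟨a1, a2⟩, ⟨b1, b2⟩, c1, c2⟩
    exact ⟨⟨a1, b1, fun k => (c1 k).1⟩, a2, b2, fun k hk => (c1 k).2 hk.symm⟩
  · rintro ⟨⟨a1, b1, c1⟩, a2, b2, c2⟩
    refine ⟨⟨a1, a2⟩, ⟨b1, b2⟩, fun k => ⟨c1 k, fun hk => c2 k hk.symm⟩, fun k hk => ?_,
      fun hk => ?_⟩ <;> omega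

/-- The number of fillings with total content `κ`. -/
noncomputable def fillingCount (P Q : (ℕ →₀ ℕ) → (ℕ →₀ ℕ) → Prop) {m : ℕ} (α : Fin m → ℕ)
    (κ : ℕ →₀ ℕ) : ℝ≥0∞ := ∑' f, ind (IsFilling P Q α f ∧ ∑ k, f k = κ)

theorem fillingCount_snoc {P Q : (ℕ →₀ ℕ) → (ℕ →₀ ℕ) → Prop} {m : ℕ} (α : Fin m → ℕ) (a : ℕ)
    (κ : ℕ →₀ ℕ) : fillingCount P Q (Fin.snoc α a : Fin (m + 1) → ℕ) κ =
      ∑' l, ∑' g, ind (l + g = κ ∧ g.degree = a ∧ P l g) *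
        ∑' f, ind (IsFilling P Q α f ∧ ∑ k, f k = l) * ind (∀ k, k.val + 1 = m → Q (f k) g) := by
  rw [fillingCount, tsum_fin_succ]
  simp_rw [← ENNReal.tsum_mul_left]
  have : ∀ F : (ℕ →₀ ℕ) → (ℕ →₀ ℕ) → (Fin m → ℕ →₀ ℕ) → ℝ≥0∞,
      ∑' l, ∑' g, ∑' f, F l g f = ∑' f, ∑' g, ∑' l, F l g f := fun F =>
    (tsum_rotate _).trans (tsum_congr fun f => ENNReal.tsum_comm)
  rw [this]
  refine tsum_congr fun f => tsum_congr fun g => ?_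
  rw [tsum_eq_single (∑ k, f k) fun l hl => by simp [ind_and, ind_of_not (Ne.symm hl)]]
  simp only [← ind_and]
  congr 1
  rw [isFilling_snoc, Fin.sum_univ_castSucc]
  simp only [Fin.snoc_castSucc, Fin.snoc_last, eq_iff_iff]
  tauto

/-- The boxes `g` can be added to the partition `l` as a horizontal strip. -/
def IsStrip (l g : ℕ →₀ ℕ) : Prop := Interlace l (l + g)

/-- The number of tableaux of shape `κ` and content `t`, as chains of strips. -/
noncomputable def kostka {n : ℕ} (t : Fin n → ℕ) (κ : ℕ →₀ ℕ) : ℝ≥0∞ :=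
  fillingCount IsStrip (fun _ _ => True) t κ

theorem tsum_isStrip (l κ : ℕ →₀ ℕ) (c : ℕ) :
    ∑' g, ind (l + g = κ ∧ g.degree = c ∧ IsStrip l g) =
      ind (Interlace l κ ∧ κ.degree = l.degree + c) := by
  by_cases h : Interlace l κ ∧ κ.degree = l.degree + c
  · have hle : l ≤ κ := fun r => (h.1 r).1
    have hadd : l + (κ - l) = κ := add_tsub_cancel_of_le hle
    have hd := congrArg Finsupp.degree hadd
    rw [map_add] at hd
    rw [ind_of h, tsum_eq_single (κ - l) fun g hg => ind_of_not fun hc => hg ?_, ind_of]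
    · exact ⟨hadd, by omega, by rw [IsStrip, hadd]; exact h.1⟩
    · rw [← hc.1]; simp
  · rw [ind_of_not h, ENNReal.tsum_eq_zero]
    rintro g
    refine ind_of_not ?_
    rintro ⟨rfl, h2, h3⟩
    exact h ⟨h3, by simp [h2]⟩

theorem kostka_snoc {n : ℕ} (t : Fin n → ℕ) (c : ℕ) (κ : ℕ →₀ ℕ) :
    kostka (Fin.snoc t c : Fin (n + 1) → ℕ) κ =
      ∑' l, ind (Interlace l κ ∧ κ.degree = l.degree + c) * kostka t l := by
  rw [kostka, fillingCount_snoc]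
  refine tsum_congr fun l => ?_
  simp only [ind_of, implies_true, mul_one]
  rw [ENNReal.tsum_mul_right, tsum_isStrip]
  rfl

theorem kostka_zero (t : Fin 0 → ℕ) (κ : ℕ →₀ ℕ) : kostka t κ = ind (κ = 0) := by
  rw [kostka, fillingCount, tsum_eq_single default fun f hf => absurd (Subsingleton.elim _ _) hf]
  congr 1
  simp [IsFilling, eq_comm]

/-- The Pieri rule. -/
theorem tsum_interlace_mul_kostka {n : ℕ} (t : Fin n → ℕ) (l : ℕ →₀ ℕ) (a : ℕ) :
    ∑' κ, ind (Interlace l κ ∧ κ.degree = l.degree + a) * kostka t κ =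
      ∑' s : Fin n → ℕ, ∑' g : Fin n → ℕ, ind (s + g = t ∧ ∑ k, g k = a) * kostka s l := by
  induction n generalizing l a with
  | zero =>
    simp only [kostka_zero, tsum_fintype, Finset.univ_unique, Finset.sum_singleton]
    simp_rw [mul_comm (ind _) (ind (_ = (0 : ℕ →₀ ℕ)))]
    rw [tsum_ind_eq_mul, ← ind_and]
    congr 1
    simp only [Interlace, Finset.univ_eq_empty, Finset.sum_empty, eq_iff_iff]
    constructor
    · rintro ⟨h1, h2⟩
      exact ⟨by ext r; have := h1 r; simp at *; omega, Subsingleton.elim _ _, by simp at h2; omega⟩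
    · rintro ⟨rfl, -, rfl⟩
      simp
  | succ n ih =>
    obtain ⟨t, c, rfl⟩ : ∃ t' c, t = (Fin.snoc t' c : Fin (n + 1) → ℕ) :=
      ⟨Fin.init t, t (Fin.last n), (Fin.snoc_init_self t).symm⟩
    -- After splitting off the last strip, `κ` lies above both `l` and `ρ`. The growth rule trades
    -- it for `μ` below both and a number `b`, the part of `a` taken from the last letter; the
    -- remaining `n` letters are left to induction.
    have lhs : ∑' κ, ind (Interlace l κ ∧ κ.degree = l.degree + a) *
        kostka (Fin.snoc t c : Fin (n + 1) → ℕ) κ =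
        ∑' b, ∑' μ, ∑' ρ, ind ((Interlace μ l ∧ Interlace μ ρ) ∧
          l.degree + b = μ.degree + c ∧ ρ.degree + b = μ.degree + a) * kostka t ρ := by
      simp_rw [kostka_snoc, ← ENNReal.tsum_mul_left]
      rw [ENNReal.tsum_comm]
      simp_rw [← mul_assoc, ENNReal.tsum_mul_right, ← ind_and]
      rw [show (∑' b, ∑' μ, ∑' ρ, ind ((Interlace μ l ∧ Interlace μ ρ) ∧
          l.degree + b = μ.degree + c ∧ ρ.degree + b = μ.degree + a) * kostka t ρ) =
          ∑' x : ℕ × (ℕ →₀ ℕ), ∑' ρ, ind ((Interlace x.2 l ∧ Interlace x.2 ρ) ∧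
          l.degree + x.1 = x.2.degree + c ∧ ρ.degree + x.1 = x.2.degree + a) * kostka t ρ from
          (ENNReal.tsum_prod' (f := fun x : ℕ × (ℕ →₀ ℕ) => ∑' ρ, ind ((Interlace x.2 l ∧ Interlace x.2 ρ) ∧
          l.degree + x.1 = x.2.degree + c ∧ ρ.degree + x.1 = x.2.degree + a) * kostka t ρ)).symm]
      rw [ENNReal.tsum_comm (α := ℕ × (ℕ →₀ ℕ))]
      refine tsum_congr fun ρ => ?_
      rw [ENNReal.tsum_mul_right, ← tsum_interlace_comm]
      congr 1
      refine tsum_congr fun κ => ?_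
      congr 1
      simp only [eq_iff_iff]
      tauto
    have rhs : ∑' s : Fin (n + 1) → ℕ, ∑' g : Fin (n + 1) → ℕ,
        ind (s + g = (Fin.snoc t c : Fin (n + 1) → ℕ) ∧ ∑ k, g k = a) * kostka s l =
        ∑' b, ∑' μ, ∑' s : Fin n → ℕ, ∑' g : Fin n → ℕ, ∑' e, ind (e = l.degree - μ.degree) *
          (ind (s + g = t ∧ e + b = c ∧ ∑ k, g k + b = a ∧ Interlace μ l) * kostka s μ) := by
      rw [tsum_fin_succ]
      simp_rw [tsum_fin_succ n (fun g => ind (_ + g = _ ∧ _) * _), kostka_snoc,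
        ← ENNReal.tsum_mul_left]
      have : ∀ F : (Fin n → ℕ) → ℕ → (Fin n → ℕ) → ℕ → (ℕ →₀ ℕ) → ℝ≥0∞,
          ∑' s, ∑' e, ∑' g, ∑' b, ∑' μ, F s e g b μ = ∑' b, ∑' μ, ∑' s, ∑' g, ∑' e, F s e g b μ := by
        intro F
        refine (tsum_congr fun s => tsum_congr fun e => (tsum_rotate _).symm).trans ?_
        refine (tsum_rotate _).trans (tsum_congr fun b => ?_)
        exact (tsum_rotate _).trans (tsum_congr fun μ => tsum_congr fun s => ENNReal.tsum_comm)
      rw [this]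
      refine tsum_congr fun b => tsum_congr fun μ => tsum_congr fun s => tsum_congr fun g =>
        tsum_congr fun e => ?_
      rw [← mul_assoc, ← mul_assoc, ← ind_and, ← ind_and]
      congr 2
      have hsnoc : (Fin.snoc s e : Fin (n + 1) → ℕ) + (Fin.snoc g b : Fin (n + 1) → ℕ) =
          (Fin.snoc t c : Fin (n + 1) → ℕ) ↔ s + g = t ∧ e + b = c := by
        simp only [funext_iff, Pi.add_apply, Fin.forall_fin_succ', Fin.snoc_castSucc, Fin.snoc_last]
      rw [hsnoc, Fin.sum_univ_castSucc]
      simp only [Fin.snoc_castSucc, Fin.snoc_last, eq_iff_iff]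
      constructor
      · rintro ⟨⟨⟨h1, h2⟩, h3⟩, h4, h5⟩
        exact ⟨by omega, h1, h2, h3, h4⟩
      · rintro ⟨h0, h1, h2, h3, h4⟩
        have hd := Finsupp.degree_mono (show μ ≤ l from fun r => (h4 r).1)
        exact ⟨⟨⟨h1, h2⟩, h3⟩, h4, by omega⟩
    rw [lhs, rhs]
    refine tsum_congr fun b => tsum_congr fun μ => ?_
    simp_rw [tsum_ind_eq_mul]
    -- When these conditions fail both sides vanish; `b ≤ a` makes the subtraction `a - b` genuine.
    by_cases h : Interlace μ l ∧ l.degree + b = μ.degree + c ∧ b ≤ a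
    · obtain ⟨h1, h2, h3⟩ := h
      have hd := Finsupp.degree_mono (show μ ≤ l from fun r => (h1 r).1)
      rw [show (fun s : Fin n → ℕ => ∑' g : Fin n → ℕ, ind (s + g = t ∧ l.degree - μ.degree + b = c ∧
          ∑ k, g k + b = a ∧ Interlace μ l) * kostka s μ) = fun s => ∑' g : Fin n → ℕ,
          ind (s + g = t ∧ ∑ k, g k = a - b) * kostka s μ from ?_, ← ih]
      · refine tsum_congr fun ρ => ?_
        congr 2
        simp only [h1, h2, true_and, eq_iff_iff]
        refine and_congr_right fun _ => ?_
        omega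
      · funext s
        refine tsum_congr fun g => ?_
        congr 2
        simp only [h1, and_true, eq_iff_iff]
        refine and_congr_right fun _ => ?_
        omega
    · refine (ENNReal.tsum_eq_zero.2 fun ρ => ?_).trans (ENNReal.tsum_eq_zero.2 fun s =>
        ENNReal.tsum_eq_zero.2 fun g => ?_).symm
      · rw [ind_of_not, zero_mul]
        rintro ⟨⟨h1, h2⟩, h3, h4⟩
        have hd := Finsupp.degree_mono (show μ ≤ ρ from fun r => (h2 r).1)
        exact h ⟨h1, h3, by omega⟩
      · rw [ind_of_not, zero_mul]
        rintro ⟨-, h1, h2, h3⟩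
        have hd := Finsupp.degree_mono (show μ ≤ l from fun r => (h3 r).1)
        exact h ⟨h3, by omega, by omega⟩

theorem tsum_ind_eq_card {X : Type*} (p : X → Prop) [Finite {x // p x}] :
    ∑' x, ind (p x) = (Nat.card {x // p x} : ℝ≥0∞) := by
  have := Fintype.ofFinite {x // p x}
  have h := tsum_ind_mul p fun _ => 1
  simp only [mul_one] at h
  rw [h, tsum_fintype]
  simp

theorem finite_filling (P Q : (ℕ →₀ ℕ) → (ℕ →₀ ℕ) → Prop) {m : ℕ} (α : Fin m → ℕ)
    (κ : ℕ →₀ ℕ) : Finite {f // IsFilling P Q α f ∧ ∑ k, f k = κ} := by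
  refine ((Set.finite_Iic fun _ : Fin m => κ).subset ?_ :
    Set.Finite {f | IsFilling P Q α f ∧ ∑ k, f k = κ})
  rintro f ⟨-, rfl⟩ k
  exact Finset.single_le_sum (f := f) (fun _ _ => zero_le) (Finset.mem_univ k)

theorem fillingCount_eq_card (P Q : (ℕ →₀ ℕ) → (ℕ →₀ ℕ) → Prop) {m : ℕ} (α : Fin m → ℕ)
    (κ : ℕ →₀ ℕ) :
    fillingCount P Q α κ = (Nat.card {f // IsFilling P Q α f ∧ ∑ k, f k = κ} : ℝ≥0∞) := by
  have := finite_filling P Q α κ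
  exact tsum_ind_eq_card _

/-! ### Merging and splitting blocks -/

/-- Some element of the multiset `h` is smaller than some element of the multiset `g`. -/
def Ascends (h g : ℕ →₀ ℕ) : Prop := ∃ u v, u < v ∧ h u ≠ 0 ∧ g v ≠ 0

/-- The `a` smallest elements of the multiset `G`. -/
noncomputable def Finsupp.takeSmallest (G : ℕ →₀ ℕ) (a : ℕ) : ℕ →₀ ℕ :=
  Finsupp.onFinset G.support
    (fun v => min (∑ u ∈ Finset.range (v + 1), G u) a - min (∑ u ∈ Finset.range v, G u) a) (by
      intro v hv
      rw [Finsupp.mem_support_iff]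
      intro h0
      simp [Finset.sum_range_succ, h0] at hv)

theorem Finsupp.takeSmallest_apply (G : ℕ →₀ ℕ) (a v : ℕ) : G.takeSmallest a v =
    min (∑ u ∈ Finset.range (v + 1), G u) a - min (∑ u ∈ Finset.range v, G u) a := rfl

theorem Finsupp.takeSmallest_le (G : ℕ →₀ ℕ) (a : ℕ) : G.takeSmallest a ≤ G := fun v => by
  rw [Finsupp.takeSmallest_apply, Finset.sum_range_succ]
  omega

theorem Finsupp.sum_range_takeSmallest (G : ℕ →₀ ℕ) (a v : ℕ) :
    ∑ u ∈ Finset.range v, G.takeSmallest a u = min (∑ u ∈ Finset.range v, G u) a := by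
  induction v with
  | zero => simp
  | succ v ih =>
    rw [Finset.sum_range_succ, ih, Finsupp.takeSmallest_apply, Finset.sum_range_succ]
    omega

theorem Finsupp.degree_takeSmallest (G : ℕ →₀ ℕ) (a : ℕ) :
    (G.takeSmallest a).degree = min G.degree a := by
  obtain ⟨N, hN⟩ := G.exists_forall_ge_eq_zero
  rw [Finsupp.degree_eq_sum_range hN, ← Finsupp.sum_range_takeSmallest]
  exact Finsupp.degree_eq_sum_range fun r hr => by
    have := G.takeSmallest_le a r
    have := hN r hr
    omega

theorem Finsupp.not_ascends_sub_takeSmallest (G : ℕ →₀ ℕ) (a : ℕ) :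
    ¬ Ascends (G - G.takeSmallest a) (G.takeSmallest a) := by
  rintro ⟨u, v, huv, hu, hv⟩
  rw [Finsupp.tsub_apply, Finsupp.takeSmallest_apply, Finset.sum_range_succ] at hu
  rw [Finsupp.takeSmallest_apply, Finset.sum_range_succ] at hv
  have : ∑ w ∈ Finset.range (u + 1), G w ≤ ∑ w ∈ Finset.range v, G w :=
    Finset.sum_le_sum_of_subset (Finset.range_subset_range.2 huv)
  rw [Finset.sum_range_succ] at this
  omega

/-- Without an ascent every element of `g` is at most every element of `h`, so `g` can be recovered
from the merged multiset. Together with `Finsupp.not_ascends_sub_takeSmallest` this makes merging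
invertible. -/
theorem Finsupp.takeSmallest_add {h g : ℕ →₀ ℕ} (hg : ¬ Ascends h g) :
    (h + g).takeSmallest g.degree = g := by
  have key : ∀ v, min (∑ u ∈ Finset.range v, (h + g) u) g.degree = ∑ u ∈ Finset.range v, g u := by
    intro v
    obtain ⟨N, hN⟩ := g.exists_forall_ge_eq_zero
    have hle : ∑ u ∈ Finset.range v, g u ≤ g.degree := by
      rw [Finsupp.degree_eq_sum_range (N := max N v) fun r hr => hN r (le_of_max_le_left hr)]
      exact Finset.sum_le_sum_of_subset (Finset.range_subset_range.2 (le_max_right _ _))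
    simp only [Finsupp.add_apply, Finset.sum_add_distrib]
    rcases Nat.eq_zero_or_pos (∑ u ∈ Finset.range v, h u) with h0 | h0
    · omega
    · obtain ⟨u, hu, hu'⟩ := Finset.exists_ne_zero_of_sum_ne_zero h0.ne'
      have hv : ∑ u ∈ Finset.range v, g u = g.degree := by
        refine (Finsupp.degree_eq_sum_range fun r hr => ?_).symm
        by_contra hc
        exact hg ⟨u, r, by rw [Finset.mem_range] at hu; omega, hu', hc⟩
      omega
  ext v
  rw [Finsupp.takeSmallest_apply, key, key, Finset.sum_range_succ]
  omega

/-- A largest element of `h + g` already lies in the nonempty `h`, and only that element matters for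
an ascent from `f`. -/
theorem ascends_add_iff {f h g : ℕ →₀ ℕ} (hg : ¬ Ascends h g) (hpos : 0 < h.degree) :
    Ascends f (h + g) ↔ Ascends f h := by
  constructor
  · rintro ⟨u, v, huv, hu, hv⟩
    by_cases hv' : h v = 0
    · obtain ⟨w, hw⟩ := Finsupp.exists_lt_of_degree_lt (f := 0) (g := h) (by simpa using hpos)
      simp only [Finsupp.coe_zero, Pi.zero_apply] at hw
      refine ⟨u, w, ?_, hu, hw.ne'⟩
      by_contra hc
      exact hg ⟨w, v, by omega, hw.ne', by simpa [hv'] using hv⟩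
    · exact ⟨u, v, huv, hu, hv'⟩
  · rintro ⟨u, v, huv, hu, hv⟩
    exact ⟨u, v, huv, hu, by simp [hv]⟩

/-- Two successive horizontal strips fail to form one only if a box of the second lies beneath one
of the first, which would be an ascent. -/
theorem isStrip_add_iff {l h g : ℕ →₀ ℕ} (hg : ¬ Ascends h g) :
    IsStrip l (h + g) ↔ IsStrip l h ∧ IsStrip (l + h) g := by
  have hg' : ∀ r, h r ≠ 0 → g (r + 1) = 0 := fun r h1 => by
    by_contra hc
    exact hg ⟨r, r + 1, by omega, h1, hc⟩
  simp only [IsStrip, Interlace, Finsupp.add_apply]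
  constructor
  · intro H
    refine ⟨fun r => ?_, fun r => ?_⟩ <;> have := H r <;> have := hg' r <;> omega
  · rintro ⟨H1, H2⟩ r
    have := H1 r; have := H2 r; have := hg' r
    omega

/-- Appending a block to a filling: either it makes an ascent with the last block, or the two
merge into a single block. -/
theorem tsum_mul_fillingCount_snoc {P : (ℕ →₀ ℕ) → (ℕ →₀ ℕ) → Prop}
    (hP : ∀ l h g, ¬ Ascends h g → (P l (h + g) ↔ P l h ∧ P (l + h) g)) {m : ℕ} (α : Fin m → ℕ)
    {b : ℕ} (hb : 0 < b) (a : ℕ) (κ : ℕ →₀ ℕ) :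
    ∑' l, ∑' g, ind (l + g = κ ∧ g.degree = a ∧ P l g) *
        fillingCount P Ascends (Fin.snoc α b : Fin (m + 1) → ℕ) l =
      fillingCount P Ascends (Fin.snoc (Fin.snoc α b : Fin (m + 1) → ℕ) a : Fin (m + 2) → ℕ) κ +
      fillingCount P Ascends (Fin.snoc α (b + a) : Fin (m + 1) → ℕ) κ := by
  have split : ∀ p : Prop, ind p + ind (¬ p) = 1 := fun p => by by_cases h : p <;> simp [ind, h]
  have hlast : ∀ (f : Fin m → ℕ →₀ ℕ) (h g : ℕ →₀ ℕ),
      (∀ k : Fin (m + 1), k.val + 1 = m + 1 → Ascends ((Fin.snoc f h : Fin (m + 1) → ℕ →₀ ℕ) k) g) ↔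
        Ascends h g := fun f h g => by
    rw [Fin.forall_fin_succ']
    simp only [Fin.snoc_last, Fin.val_last]
    exact ⟨fun H => H.2 trivial, fun H =>
      ⟨fun k hk => by have := k.2; simp at hk; omega, fun _ => H⟩⟩
  have e1 : ∑' l, ∑' g, ind (l + g = κ ∧ g.degree = a ∧ P l g) *
        fillingCount P Ascends (Fin.snoc α b : Fin (m + 1) → ℕ) l =
      fillingCount P Ascends (Fin.snoc (Fin.snoc α b : Fin (m + 1) → ℕ) a : Fin (m + 2) → ℕ) κ +
      ∑' l, ∑' g, ∑' f : Fin m → ℕ →₀ ℕ, ∑' h, ind (l + g = κ ∧ g.degree = a ∧ P l g) *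
        (ind ((IsFilling P Ascends α f ∧ h.degree = b ∧ P (∑ k, f k) h ∧
          ∀ k, k.val + 1 = m → Ascends (f k) h) ∧ (∑ k, f k) + h = l) * ind (¬ Ascends h g)) := by
    rw [fillingCount_snoc (Fin.snoc α b : Fin (m + 1) → ℕ) a, ← ENNReal.tsum_add]
    refine tsum_congr fun l => ?_
    rw [← ENNReal.tsum_add]
    refine tsum_congr fun g => ?_
    simp_rw [ENNReal.tsum_mul_left]
    rw [← mul_add, fillingCount, tsum_fin_succ, tsum_fin_succ, ← ENNReal.tsum_add]
    congr 1
    refine tsum_congr fun f => ?_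
    rw [← ENNReal.tsum_add]
    refine tsum_congr fun h => ?_
    rw [hlast, isFilling_snoc, Fin.sum_univ_castSucc]
    simp only [Fin.snoc_castSucc, Fin.snoc_last]
    rw [← mul_add, split, mul_one]
  rw [e1]
  congr 1
  rw [fillingCount, tsum_fin_succ]
  rw [show (∑' l, ∑' g, ∑' f : Fin m → ℕ →₀ ℕ, ∑' h, ind (l + g = κ ∧ g.degree = a ∧ P l g) *
        (ind ((IsFilling P Ascends α f ∧ h.degree = b ∧ P (∑ k, f k) h ∧
          ∀ k, k.val + 1 = m → Ascends (f k) h) ∧ (∑ k, f k) + h = l) * ind (¬ Ascends h g))) =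
      ∑' f : Fin m → ℕ →₀ ℕ, ∑' g, ∑' h, ∑' l, ind (l + g = κ ∧ g.degree = a ∧ P l g) *
        (ind ((IsFilling P Ascends α f ∧ h.degree = b ∧ P (∑ k, f k) h ∧
          ∀ k, k.val + 1 = m → Ascends (f k) h) ∧ (∑ k, f k) + h = l) * ind (¬ Ascends h g)) from
    (tsum_rotate _).trans (tsum_congr fun f => (tsum_rotate _).symm)]
  refine tsum_congr fun f => ?_
  rw [ENNReal.tsum_comm, ← ENNReal.tsum_prod]
  -- Non-ascending pairs `(h, g)` of sizes `b` and `a` correspond to blocks of size `b + a`, with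
  -- `g` the `a` smallest elements.
  refine Eq.trans (tsum_congr fun x => ?_) (tsum_ind_congr (p := fun x : (ℕ →₀ ℕ) × (ℕ →₀ ℕ) =>
    ((IsFilling P Ascends α f ∧ x.1.degree = b ∧ P (∑ k, f k) x.1 ∧
          ∀ k, k.val + 1 = m → Ascends (f k) x.1) ∧ ¬ Ascends x.1 x.2) ∧ (∑ k, f k) + x.1 + x.2 = κ ∧
          x.2.degree = a ∧ P (∑ k, f k + x.1) x.2)
    (fun x => x.1 + x.2) (fun G => (G - G.takeSmallest a, G.takeSmallest a)) ?_ ?_)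
  · rw [tsum_eq_single ((∑ k, f k) + x.1) fun l hl => by
      rw [ind_and _ (_ = l), ind_of_not (Ne.symm hl)]; simp]
    rw [← ind_and, ← ind_and]
    congr 1
    simp only [eq_iff_iff]
    tauto
  · rintro ⟨h, g⟩ ⟨⟨⟨h1, h2, h3, h4⟩, h5⟩, h6, h7, h8⟩
    simp only at h2 h3 h4 h5 h6 h7 h8
    refine ⟨?_, ?_⟩
    · rw [isFilling_snoc, Fin.sum_univ_castSucc]
      simp only [Fin.snoc_castSucc, Fin.snoc_last]
      exact ⟨⟨h1, by simp [h2, h7], (hP _ _ _ h5).2 ⟨h3, h8⟩, fun k hk =>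
        (ascends_add_iff h5 (by omega)).2 (h4 k hk)⟩, by rw [← add_assoc, h6]⟩
    · simp only [← h7, Finsupp.takeSmallest_add h5]
      simp
  · intro G hG
    rw [isFilling_snoc, Fin.sum_univ_castSucc] at hG
    simp only [Fin.snoc_castSucc, Fin.snoc_last] at hG
    obtain ⟨⟨h1, h2, h3, h4⟩, h5⟩ := hG
    have c1 := G.not_ascends_sub_takeSmallest a
    have c2 : G - G.takeSmallest a + G.takeSmallest a = G :=
      tsub_add_cancel_of_le (G.takeSmallest_le a)
    have c3 := G.degree_takeSmallest a
    have c4 := congrArg Finsupp.degree c2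
    rw [map_add] at c4
    have c5 : (G - G.takeSmallest a).degree = b := by omega
    have c6 := hP (∑ k, f k) _ _ c1
    rw [c2] at c6
    refine ⟨⟨⟨⟨h1, c5, (c6.1 h3).1, fun k hk => ?_⟩, c1⟩, ?_, by simp only; omega, (c6.1 h3).2⟩, c2⟩
    · have := h4 k hk
      rwa [← c2, ascends_add_iff c1 (by omega)] at this
    · simp only [add_assoc, c2]
      exact h5

/-! ### From chains with ascents to fillings of the ribbon -/

theorem kostka_zero_shape {n : ℕ} (t : Fin n → ℕ) : kostka t 0 = ind (t = 0) := by
  rw [kostka, fillingCount]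
  rw [tsum_eq_single 0 fun f hf => ind_of_not ?_]
  · congr 1
    simp [IsFilling, IsStrip, Interlace, funext_iff, eq_comm]
  · rintro ⟨-, h⟩
    exact hf (funext fun k => (Finset.sum_eq_zero_iff.1 h) k (Finset.mem_univ k))

/-- Summands of `t` vanish from `n` on, just as `t` does. This passes to contents indexed by `Fin
n`, where the Pieri rule is stated. -/
theorem tsum_content_restrict {n : ℕ} {t : ℕ →₀ ℕ} (ht : ∀ j, n ≤ j → t j = 0) (a : ℕ)
    (G : (Fin n → ℕ) → ℝ≥0∞) :
    ∑' l : ℕ →₀ ℕ, ∑' g : ℕ →₀ ℕ, ind (l + g = t ∧ g.degree = a) * G (fun j => l j) =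
      ∑' s : Fin n → ℕ, ∑' g : Fin n → ℕ, ind (s + g = (fun j : Fin n => t j) ∧ ∑ k, g k = a) * G s := by
  set ext : (Fin n → ℕ) → (ℕ →₀ ℕ) := fun s =>
    (Finsupp.equivFunOnFinite.symm s).mapDomain Fin.val with hext
  have ext_val : ∀ s (j : Fin n), ext s j = s j := fun s j => by
    simp [hext, Finsupp.mapDomain_apply Fin.val_injective]
  have ext_ge : ∀ s j, n ≤ j → ext s j = 0 := fun s j hj => by
    rw [hext]
    refine Finsupp.mapDomain_of_notMem_range _ _ ?_
    rintro ⟨k, rfl⟩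
    have := k.2; omega
  have ext_deg : ∀ s, (ext s).degree = ∑ k, s k := fun s => by
    rw [hext]; simp only [Finsupp.degree_mapDomain]; rw [Finsupp.degree_eq_sum]; rfl
  have ext_res : ∀ l : ℕ →₀ ℕ, (∀ j, n ≤ j → l j = 0) → ext (fun j => l j) = l := fun l hl => by
    ext j
    rcases lt_or_ge j n with h | h
    · exact ext_val _ ⟨j, h⟩
    · rw [ext_ge _ _ h, hl j h]
  rw [← ENNReal.tsum_prod, ← ENNReal.tsum_prod]
  refine tsum_ind_mul_congr (p := fun x : (ℕ →₀ ℕ) × (ℕ →₀ ℕ) => x.1 + x.2 = t ∧ x.2.degree = a)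
    (q := fun x : (Fin n → ℕ) × (Fin n → ℕ) => x.1 + x.2 = (fun j : Fin n => t j) ∧ ∑ k, x.2 k = a)
    (fun x => (fun j => x.1 j, fun j => x.2 j)) (fun x => (ext x.1, ext x.2)) ?_ ?_ (fun x => G x.1)
  · rintro ⟨l, g⟩ ⟨h1, h2⟩
    simp only at h1 h2
    have hl : ∀ j, n ≤ j → l j + g j = 0 := fun j hj => by rw [← Finsupp.add_apply, h1, ht j hj]
    have hg' := ext_res g fun j hj => by have := hl j hj; omega
    have hl' := ext_res l fun j hj => by have := hl j hj; omega
    refine ⟨⟨funext fun j => by simp [← h1], ?_⟩, by simp only [hg', hl']⟩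
    rw [← ext_deg, hg', h2]
  · rintro ⟨s, g⟩ ⟨h1, h2⟩
    simp only at h1 h2
    refine ⟨⟨?_, by simp only [ext_deg, h2]⟩, ?_⟩
    · rw [← ext_res t ht, ← h1]
      ext j
      rcases lt_or_ge j n with h | h
      · simp only [Finsupp.add_apply]
        rw [ext_val s ⟨j, h⟩, ext_val g ⟨j, h⟩, ext_val _ ⟨j, h⟩]; rfl
      · simp [ext_ge _ _ h]
    · simp only [ext_val]

/-- Multiplication by `h_a`: on contents it adds an arbitrary multiset of size `a`, on shapes a
horizontal strip of size `a`, and the Pieri rule carries one to the other. -/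
theorem tsum_append_block {n : ℕ} {F₀ F₁ : (ℕ →₀ ℕ) → ℝ≥0∞}
    (hF : ∀ t : ℕ →₀ ℕ, (∀ j, n ≤ j → t j = 0) →
      F₀ t = ∑' κ, F₁ κ * kostka (fun j : Fin n => t j) κ) (a : ℕ)
    {t : ℕ →₀ ℕ} (ht : ∀ j, n ≤ j → t j = 0) :
    ∑' l, ∑' g, ind (l + g = t ∧ g.degree = a ∧ True) * F₀ l =
      ∑' κ, (∑' l, ∑' g, ind (l + g = κ ∧ g.degree = a ∧ IsStrip l g) * F₁ l) *
        kostka (fun j : Fin n => t j) κ := by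
  calc
    _ = ∑' l : ℕ →₀ ℕ, ∑' g : ℕ →₀ ℕ, ind (l + g = t ∧ g.degree = a) *
          (fun s : Fin n → ℕ => ∑' κ, F₁ κ * kostka s κ) (fun j => l j) := by
      refine tsum_congr fun l => tsum_congr fun g => ?_
      simp only [and_true]
      refine ind_mul_congr fun h => hF l fun j hj => ?_
      have := ht j hj
      rw [← h.1, Finsupp.add_apply] at this
      omega
    _ = ∑' κ, F₁ κ * ∑' s : Fin n → ℕ, ∑' g : Fin n → ℕ,
          ind (s + g = (fun j : Fin n => t j) ∧ ∑ k, g k = a) * kostka s κ := by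
      refine (tsum_content_restrict ht a fun s : Fin n → ℕ => ∑' κ, F₁ κ * kostka s κ).trans ?_
      simp_rw [← ENNReal.tsum_mul_left]
      rw [tsum_rotate]
      refine tsum_congr fun κ => tsum_congr fun s => tsum_congr fun g => ?_
      ring
    _ = _ := by
      simp_rw [← tsum_interlace_mul_kostka, ENNReal.tsum_mul_right, tsum_isStrip,
        ← ENNReal.tsum_mul_left, ← ENNReal.tsum_mul_right]
      rw [ENNReal.tsum_comm]
      refine tsum_congr fun κ => tsum_congr fun l => ?_
      ring

/-- Appending a block of size `a` after one of size `b` gives the same recursion on both sides: a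
term with the blocks separate and a term with them merged. The merged term has fewer blocks, so it
is known by induction and can be cancelled. -/
theorem fillingCount_eq_tsum_kostka {n : ℕ} {m : ℕ} (α : Fin m → ℕ) (hα : ∀ k, 0 < α k)
    {t : ℕ →₀ ℕ} (ht : ∀ j, n ≤ j → t j = 0) :
    fillingCount (fun _ _ => True) Ascends α t =
      ∑' κ, fillingCount IsStrip Ascends α κ * kostka (fun j : Fin n => t j) κ := by
  induction m generalizing t with
  | zero =>
    have h0 : ∀ P κ, fillingCount P Ascends α κ = ind (κ = 0) := fun P κ => by
      rw [fillingCount, tsum_eq_single default fun f hf => absurd (Subsingleton.elim _ _) hf]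
      congr 1
      simp [IsFilling, eq_comm]
    simp_rw [h0]
    rw [tsum_ind_eq_mul, kostka_zero_shape]
    congr 1
    simp only [eq_iff_iff]
    refine ⟨fun h => by simp [h, funext_iff], fun h => ?_⟩
    ext j
    rcases lt_or_ge j n with hj | hj
    · exact congrFun h ⟨j, hj⟩
    · exact ht j hj
  | succ m ih =>
    obtain ⟨α, a, rfl⟩ : ∃ α' a, α = (Fin.snoc α' a : Fin (m + 1) → ℕ) :=
      ⟨Fin.init α, α (Fin.last m), (Fin.snoc_init_self α).symm⟩
    have hα' : ∀ k, 0 < α k := fun k => by simpa using hα k.castSucc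
    have ha : 0 < a := by simpa using hα (Fin.last m)
    have happ := tsum_append_block (fun t ht => ih α hα' (t := t) ht) a ht
    rcases m with _ | m
    · have h0 : ∀ P κ, fillingCount P Ascends (Fin.snoc α a : Fin 1 → ℕ) κ =
          ∑' l, ∑' g, ind (l + g = κ ∧ g.degree = a ∧ P l g) * fillingCount P Ascends α l :=
        fun P κ => by
          rw [fillingCount_snoc]
          refine tsum_congr fun l => tsum_congr fun g => ?_
          congr 1
          refine tsum_congr fun f => ?_
          rw [ind_of (fun k : Fin 0 => k.elim0), mul_one]
      simp_rw [h0]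
      exact happ
    · obtain ⟨α, b, rfl⟩ : ∃ α' b, α = (Fin.snoc α' b : Fin (m + 1) → ℕ) :=
        ⟨Fin.init α, α (Fin.last m), (Fin.snoc_init_self α).symm⟩
      have hα'' : ∀ k, 0 < α k := fun k => by simpa using hα' k.castSucc
      have hb : 0 < b := by simpa using hα' (Fin.last m)
      rw [tsum_mul_fillingCount_snoc (fun _ _ _ _ => by simp) α hb] at happ
      simp_rw [tsum_mul_fillingCount_snoc (P := IsStrip) (fun l h g => isStrip_add_iff) α hb, add_mul,
        ENNReal.tsum_add] at happ
      rw [← ih (Fin.snoc α (b + a)) (fun k => by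
        refine Fin.lastCases ?_ (fun k => ?_) k
        · simp; omega
        · simpa using hα'' k) ht] at happ
      -- Cancellation in `ℝ≥0∞` needs the merged term to be finite; it is a cardinality.
      refine (ENNReal.add_left_inj ?_).1 happ
      rw [fillingCount_eq_card]
      exact ENNReal.natCast_ne_top _

/-! ### Weakly increasing rows and their contents -/

/-- The multiset of the first `n` values of `e`. -/
noncomputable def rowContent (e : ℕ → ℕ) (n : ℕ) : ℕ →₀ ℕ :=
  ∑ c ∈ Finset.range n, Finsupp.single (e c) 1

theorem rowContent_apply (e : ℕ → ℕ) (n v : ℕ) :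
    rowContent e n v = ((Finset.range n).filter fun c => e c = v).card := by
  simp [rowContent, Finsupp.finsetSum_apply, Finsupp.single_apply, Finset.sum_boole]

theorem degree_rowContent (e : ℕ → ℕ) (n : ℕ) : (rowContent e n).degree = n := by
  simp [rowContent]

theorem sum_range_rowContent (e : ℕ → ℕ) (n v : ℕ) :
    ∑ u ∈ Finset.range v, rowContent e n u = ((Finset.range n).filter fun c => e c < v).card := by
  simp_rw [rowContent_apply]
  rw [Finset.card_eq_sum_card_fiberwise (f := e) (t := Finset.range v)]
  · refine Finset.sum_congr rfl fun u hu => ?_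
    congr 1
    ext c
    simp only [Finset.mem_filter, Finset.mem_range] at *
    constructor
    · rintro ⟨h1, rfl⟩; exact ⟨⟨h1, hu⟩, rfl⟩
    · rintro ⟨⟨h1, -⟩, rfl⟩; exact ⟨h1, rfl⟩
  · intro c hc
    simpa using (Finset.mem_filter.1 hc).2

theorem lt_iff_lt_sum_rowContent {e : ℕ → ℕ} {n : ℕ}
    (he : ∀ c c', c < c' → c' < n → e c ≤ e c') {c : ℕ} (hc : c < n) (v : ℕ) :
    e c < v ↔ c < ∑ u ∈ Finset.range v, rowContent e n u := by
  rw [sum_range_rowContent]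
  constructor
  · intro h
    have : Finset.range (c + 1) ⊆ (Finset.range n).filter fun c => e c < v := fun d hd => by
      simp only [Finset.mem_range, Finset.mem_filter] at *
      refine ⟨by omega, ?_⟩
      rcases (Nat.lt_succ_iff.1 hd).eq_or_lt with rfl | h1
      · exact h
      · exact (he d c h1 hc).trans_lt h
    simpa using Finset.card_le_card this
  · intro h
    by_contra hc'
    have : (Finset.range n).filter (fun c => e c < v) ⊆ Finset.range c := fun d hd => by
      simp only [Finset.mem_range, Finset.mem_filter] at *
      by_contra hdc
      rcases (not_lt.1 hdc).eq_or_lt with rfl | h1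
      · exact hc' hd.2
      · have := he c d h1 hd.1; omega
    have := Finset.card_le_card this
    simp at this
    omega

/-- The weakly increasing sequence with content `g`. -/
noncomputable def fillRow (g : ℕ →₀ ℕ) (c : ℕ) : ℕ :=
  sInf {v | c < ∑ u ∈ Finset.range (v + 1), g u}

theorem Finsupp.sum_range_le_degree (g : ℕ →₀ ℕ) (v : ℕ) :
    ∑ u ∈ Finset.range v, g u ≤ g.degree := by
  obtain ⟨N, hN⟩ := g.exists_forall_ge_eq_zero
  rw [Finsupp.degree_eq_sum_range (N := max N v) fun r hr => hN r (le_of_max_le_left hr)]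
  exact Finset.sum_le_sum_of_subset (Finset.range_subset_range.2 (le_max_right _ _))

/-- The bound on `c` makes the set defining `fillRow` nonempty, so that `sInf` does not take its
default value. Comparisons of entries thereby become comparisons of partial sums. -/
theorem fillRow_lt_iff {g : ℕ →₀ ℕ} {c : ℕ} (hc : c < g.degree) (v : ℕ) :
    fillRow g c < v ↔ c < ∑ u ∈ Finset.range v, g u := by
  have hne : {v | c < ∑ u ∈ Finset.range (v + 1), g u}.Nonempty := by
    obtain ⟨N, hN⟩ := g.exists_forall_ge_eq_zero
    refine ⟨N, ?_⟩
    rw [Finsupp.degree_eq_sum_range (N := N + 1) fun r hr => hN r (by omega)] at hc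
    exact hc
  rcases v with _ | v
  · simp
  rw [Nat.lt_succ_iff]
  constructor
  · intro h
    exact (Nat.sInf_mem hne).trans_le
      (Finset.sum_le_sum_of_subset (Finset.range_subset_range.2 (by unfold fillRow at h; omega)))
  · intro h
    exact Nat.sInf_le h

theorem fillRow_mono {g : ℕ →₀ ℕ} {c c' : ℕ} (h : c ≤ c') (hc' : c' < g.degree) :
    fillRow g c ≤ fillRow g c' := by
  rw [← Nat.lt_succ_iff, fillRow_lt_iff (by omega)]
  have := (fillRow_lt_iff hc' (fillRow g c' + 1)).1 (by omega)
  simp only [Nat.succ_eq_add_one]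
  omega

theorem rowContent_fillRow (g : ℕ →₀ ℕ) : rowContent (fillRow g) g.degree = g := by
  have key : ∀ v, ∑ u ∈ Finset.range v, rowContent (fillRow g) g.degree u =
      ∑ u ∈ Finset.range v, g u := fun v => by
    have h1 := g.sum_range_le_degree v
    rw [sum_range_rowContent, show ((Finset.range g.degree).filter fun c => fillRow g c < v) =
      Finset.range (∑ u ∈ Finset.range v, g u) from ?_, Finset.card_range]
    ext c
    simp only [Finset.mem_filter, Finset.mem_range]
    constructor
    · rintro ⟨h1, h2⟩; exact (fillRow_lt_iff h1 v).1 h2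
    · intro h; exact ⟨by omega, (fillRow_lt_iff (by omega) v).2 h⟩
  ext v
  have h1 := key v
  have h2 := key (v + 1)
  rw [Finset.sum_range_succ, Finset.sum_range_succ] at h2
  omega

theorem fillRow_rowContent {e : ℕ → ℕ} {n : ℕ} (he : ∀ c c', c < c' → c' < n → e c ≤ e c')
    {c : ℕ} (hc : c < n) : fillRow (rowContent e n) c = e c := by
  have h : ∀ v, fillRow (rowContent e n) c < v ↔ e c < v := fun v => by
    rw [fillRow_lt_iff (by rwa [degree_rowContent]), lt_iff_lt_sum_rowContent he hc]
  have h1 := h (e c + 1)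
  have h2 := h (e c)
  omega

theorem sum_cells_eq {ι M : Type*} [AddCommMonoid M] (s : Finset ι) {row : ι → ℕ}
    (hrow : Function.Injective row) (o len : ι → ℕ) {cells : Finset (ℕ × ℕ)}
    (h : ∀ r c, (r, c) ∈ cells ↔ ∃ k ∈ s, row k = r ∧ o k ≤ c ∧ c < o k + len k)
    (F : ℕ × ℕ → M) :
    ∑ x ∈ cells, F x = ∑ k ∈ s, ∑ c ∈ Finset.range (len k), F (row k, o k + c) := by
  rw [Finset.sum_sigma']
  symm
  refine Finset.sum_bij (fun x _ => (row x.1, o x.1 + x.2)) ?_ ?_ ?_ (fun _ _ => rfl)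
  · rintro ⟨k, c⟩ hx
    simp only [Finset.mem_sigma, Finset.mem_range] at hx
    exact (h _ _).2 ⟨k, hx.1, rfl, by simp, by simpa using hx.2⟩
  · rintro ⟨k, c⟩ - ⟨k', c'⟩ - heq
    simp only [Prod.mk.injEq] at heq
    obtain rfl := hrow heq.1
    simpa using heq.2
  · rintro ⟨r, c⟩ hx
    obtain ⟨k, hk, rfl, h1, h2⟩ := (h r c).1 hx
    exact ⟨⟨k, c - o k⟩, Finset.mem_sigma.2 ⟨hk, Finset.mem_range.2 (by simp only; omega)⟩,
      by simp; omega⟩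

/-! ### Ribbon tableaux as fillings with ascents -/

namespace Ribbon

variable {m : ℕ} {α : Fin m → ℕ}

theorem fillingContent_shape (hα : ∀ k, 0 < α k) (T : ℕ → ℕ → ℕ) :
    fillingContent (shape α).cells T =
      ∑ k : Fin m, rowContent (fun c => T k (offset α k + c)) (α k) := by
  rw [fillingContent, sum_cells_eq Finset.univ Fin.val_injective (offset α) α]
  · rfl
  · intro r c
    rw [mem_shape_cells hα]
    constructor
    · rintro ⟨h, h1⟩; exact ⟨⟨r, h⟩, Finset.mem_univ _, rfl, h1⟩
    · rintro ⟨k, -, rfl, h1⟩; exact ⟨k.2, h1⟩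

/-- Rows of length at least two prevent a column from meeting three rows, so column strictness
concerns adjacent rows only. -/
theorem succ_of_mem_column (hα : ∀ k, 2 ≤ α k) {k k' : Fin m} (hk : k < k') {c : ℕ}
    (h₁ : offset α k ≤ c) (h₂ : c < offset α k' + α k') :
    k'.val = k.val + 1 ∧ c = offset α k ∧ offset α k' + α k' = offset α k + 1 := by
  have hpos : ∀ k, 0 < α k := fun k => by have := hα k; omega
  have hk' : k.val < k'.val := hk
  set k₁ : Fin m := ⟨k + 1, by omega⟩ with hk₁
  have e1 := offset_eq_of_succ hpos (i := k) (j := k₁) rfl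
  rcases (show k.val + 1 ≤ k' from hk').eq_or_lt with h | h
  · have : k₁ = k' := Fin.ext h
    rw [this] at e1
    omega
  · exfalso
    set k₂ : Fin m := ⟨k + 2, by omega⟩ with hk₂
    have e2 := offset_eq_of_succ hpos (i := k₁) (j := k₂) rfl
    have e3 : offset α k' + (α k' - 1) + 1 ≤ offset α k₂ + (α k₂ - 1) + 1 :=
      offset_add_antitone α (show k₂ ≤ k' from h)
    have := hα k₁; have := hα k₂; have := hα k'
    omega

/-- A tableau of ribbon shape is determined by the contents of its rows. -/
noncomputable def tableauEquiv (hα : ∀ k, 2 ≤ α k) (t : ℕ →₀ ℕ) :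
    {T : SkewTableau (shape α) // fillingContent (shape α).cells T.entry = t} ≃
      {f : Fin m → ℕ →₀ ℕ // IsFilling (fun _ _ => True) Ascends α f ∧ ∑ k, f k = t} where
  toFun T := ⟨fun k => rowContent (fun c => T.1.entry k (offset α k + c)) (α k), by
    have hpos : ∀ k, 0 < α k := fun k => by have := hα k; omega
    refine ⟨⟨fun k => degree_rowContent _ _, fun _ => trivial, fun k k' hk => ?_⟩, ?_⟩
    · have h1 := hα k
      have h2 := hα k'
      have h3 := offset_eq_of_succ hpos hk
      -- The shared column holds the first box of the upper row and the last of the lower one: the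
      -- minimum of one content and the maximum of the other. Column strictness is thus precisely
      -- `Ascends`.
      refine ⟨T.1.entry k (offset α k), T.1.entry k' (offset α k), ?_, ?_, ?_⟩
      · refine T.1.col_strict (by omega) ?_ ?_ <;> rw [mem_shape_cells hpos]
        · exact ⟨k.2, by simp only [Fin.eta]; omega⟩
        · exact ⟨k'.2, by simp only [Fin.eta]; omega⟩
      · rw [rowContent_apply, ← Nat.pos_iff_ne_zero, Finset.card_pos]
        exact ⟨0, by simp; omega⟩
      · rw [rowContent_apply, ← Nat.pos_iff_ne_zero, Finset.card_pos]
        refine ⟨α k' - 1, ?_⟩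
        rw [Finset.mem_filter, Finset.mem_range]
        exact ⟨by omega, by congr 1; omega⟩
    · rw [← fillingContent_shape hpos, T.2]⟩
  invFun f := ⟨{
      entry := fun r c => if h : r < m then
        (if offset α ⟨r, h⟩ ≤ c ∧ c < offset α ⟨r, h⟩ + α ⟨r, h⟩ then
          fillRow (f.1 ⟨r, h⟩) (c - offset α ⟨r, h⟩) else 0) else 0
      row_weak := by
        intro r c c' hc h1 h2
        have hpos : ∀ k, 0 < α k := fun k => by have := hα k; omega
        rw [mem_shape_cells hpos] at h1 h2
        obtain ⟨h, h1⟩ := h1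
        obtain ⟨_, h2⟩ := h2
        simp only [h, dif_pos, if_pos h1, if_pos h2]
        exact fillRow_mono (by omega) (by rw [f.2.1.1]; omega)
      col_strict := by
        intro r r' c hr h1 h2
        have hpos : ∀ k, 0 < α k := fun k => by have := hα k; omega
        rw [mem_shape_cells hpos] at h1 h2
        obtain ⟨h, h1⟩ := h1
        obtain ⟨h', h2⟩ := h2
        simp only [h, h', dif_pos, if_pos h1, if_pos h2]
        obtain ⟨e1, e2, e3⟩ := succ_of_mem_column hα
          (show (⟨r, h⟩ : Fin m) < ⟨r', h'⟩ from hr) h1.1 h2.2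
        obtain ⟨u, v, huv, hu, hv⟩ := f.2.1.2.2 ⟨r, h⟩ ⟨r', h'⟩ e1
        have d1 := f.2.1.1 ⟨r, h⟩
        have d2 := f.2.1.1 ⟨r', h'⟩
        have a1 := hα ⟨r, h⟩
        have a2 := hα ⟨r', h'⟩
        have b1 := (fillRow_lt_iff (g := f.1 ⟨r, h⟩) (c := c - offset α ⟨r, h⟩) (by omega) (u + 1)).2 (by
          rw [Finset.sum_range_succ]; omega)
        have b2 := fillRow_lt_iff (g := f.1 ⟨r', h'⟩) (c := c - offset α ⟨r', h'⟩) (by omega) v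
        have b3 := (f.1 ⟨r', h'⟩).sum_range_le_degree (v + 1)
        rw [Finset.sum_range_succ] at b3
        omega
      zeros := by
        intro r c hc
        have hpos : ∀ k, 0 < α k := fun k => by have := hα k; omega
        rw [mem_shape_cells hpos] at hc
        split_ifs with h1 h2
        · exact absurd ⟨h1, h2⟩ hc
        · rfl
        · rfl }, by
      have hpos : ∀ k, 0 < α k := fun k => by have := hα k; omega
      rw [fillingContent_shape hpos]
      refine Eq.trans (Finset.sum_congr rfl fun k _ => ?_) f.2.2
      conv_rhs => rw [← rowContent_fillRow (f.1 k), f.2.1.1 k]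
      refine Finset.sum_congr rfl fun c hc => ?_
      rw [Finset.mem_range] at hc
      simp [hc]⟩
  left_inv T := by
    have hpos : ∀ k, 0 < α k := fun k => by have := hα k; omega
    refine Subtype.ext (SkewTableau.ext (funext fun r => funext fun c => ?_))
    simp only
    split_ifs with h1 h2
    · rw [fillRow_rowContent _ (by omega)]
      · congr 1; omega
      · intro c c' hc hc'
        refine T.1.row_weak (by omega) ?_ ?_ <;> rw [mem_shape_cells hpos] <;>
          exact ⟨h1, by omega⟩
    · rw [T.1.zeros]
      rw [mem_shape_cells hpos]
      rintro ⟨_, h3⟩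
      exact h2 h3
    · rw [T.1.zeros]
      rw [mem_shape_cells hpos]
      rintro ⟨h3, -⟩
      exact h1 h3
  right_inv f := by
    refine Subtype.ext (funext fun k => ?_)
    simp only
    conv_rhs => rw [← rowContent_fillRow (f.1 k), f.2.1.1 k]
    refine Finset.sum_congr rfl fun c hc => ?_
    rw [Finset.mem_range] at hc
    simp [hc]

end Ribbon

/-! ### Straight tableaux as chains of strips -/

namespace YoungDiagram

/-- The row lengths of a Young diagram. -/
noncomputable def rowLengths (ν : YoungDiagram) : ℕ →₀ ℕ :=
  Finsupp.onFinset (Finset.range (ν.colLen 0)) ν.rowLen fun r hr => by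
    rw [Finset.mem_range, ← mem_iff_lt_colLen, mem_iff_lt_rowLen]
    omega

@[simp]
theorem rowLengths_apply (ν : YoungDiagram) (r : ℕ) : ν.rowLengths r = ν.rowLen r := rfl

theorem rowLen_eq_zero {ν : YoungDiagram} {r : ℕ} (hr : ν.colLen 0 ≤ r) : ν.rowLen r = 0 := by
  by_contra h
  have : (r, 0) ∈ ν := mem_iff_lt_rowLen.2 (by omega)
  rw [mem_iff_lt_colLen] at this
  omega

theorem fillingContent_cells (ν : YoungDiagram) (T : ℕ → ℕ → ℕ) :
    fillingContent ν.cells T =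
      ∑ r ∈ Finset.range (ν.colLen 0), rowContent (T r) (ν.rowLen r) := by
  rw [fillingContent, sum_cells_eq (Finset.range (ν.colLen 0)) Function.injective_id 0 ν.rowLen]
  · simp [rowContent]
  · intro r c
    rw [mem_cells]
    constructor
    · intro h
      refine ⟨r, ?_, rfl, by simp, by simpa using mem_iff_lt_rowLen.1 h⟩
      rw [Finset.mem_range, ← mem_iff_lt_colLen]
      exact ν.up_left_mem le_rfl (Nat.zero_le _) h
    · rintro ⟨k, -, rfl, -, h⟩
      exact mem_iff_lt_rowLen.2 (by simpa using h)

/-- Transposition of a finite family of contents. -/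
noncomputable def _root_.contentTranspose {n : ℕ} (f : Fin n → ℕ →₀ ℕ) (r : ℕ) : ℕ →₀ ℕ :=
  ∑ v : Fin n, Finsupp.single v.val (f v r)

theorem _root_.contentTranspose_val {n : ℕ} (f : Fin n → ℕ →₀ ℕ) (r : ℕ) (v : Fin n) :
    contentTranspose f r v = f v r := by
  simp [contentTranspose, Finsupp.finsetSum_apply, Finsupp.single_apply, Fin.val_inj]

theorem _root_.contentTranspose_of_ge {n : ℕ} (f : Fin n → ℕ →₀ ℕ) (r : ℕ) {v : ℕ} (hv : n ≤ v) :
    contentTranspose f r v = 0 := by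
  simp only [contentTranspose, Finsupp.finsetSum_apply]
  refine Finset.sum_eq_zero fun j _ => ?_
  rw [Finsupp.single_apply, if_neg]
  have := j.2; omega

theorem _root_.degree_contentTranspose {n : ℕ} (f : Fin n → ℕ →₀ ℕ) (r : ℕ) :
    (contentTranspose f r).degree = (∑ v, f v) r := by
  simp [contentTranspose, Finsupp.finsetSum_apply]

theorem _root_.sum_range_contentTranspose {n : ℕ} (f : Fin n → ℕ →₀ ℕ) (r : ℕ) (v : Fin n) :
    ∑ u ∈ Finset.range v, contentTranspose f r u = (∑ j ∈ Finset.Iio v, f j) r := by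
  rw [show Finset.range v = (Finset.Iio v).map Fin.valEmbedding by
    rw [Fin.map_valEmbedding_Iio]; ext; simp, Finset.sum_map, Finsupp.finsetSum_apply]
  exact Finset.sum_congr rfl fun j _ => contentTranspose_val f r j

/-- The strip condition for the letter `w` says that row `r + 1` has at most as many entries `≤ w`
as row `r` has entries `< w`, which is column strictness. -/
theorem fillRow_contentTranspose_lt {ν : YoungDiagram} {n : ℕ} {t : Fin n → ℕ}
    {f : Fin n → ℕ →₀ ℕ} (hf : IsFilling IsStrip (fun _ _ => True) t f)
    (hν : ∑ k, f k = ν.rowLengths) {r r' c : ℕ} (hr : r < r') (hc : (r', c) ∈ ν) :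
    fillRow (contentTranspose f r) c < fillRow (contentTranspose f r') c := by
  have hdeg : ∀ r, (contentTranspose f r).degree = ν.rowLen r := fun r => by
    rw [degree_contentTranspose, hν, rowLengths_apply]
  have step : ∀ r, (r + 1, c) ∈ ν →
      fillRow (contentTranspose f r) c < fillRow (contentTranspose f (r + 1)) c := by
    intro r hc
    have hc' := mem_iff_lt_rowLen.1 hc
    have hc'' := mem_iff_lt_rowLen.1 (ν.up_left_mem (Nat.le_succ r) le_rfl hc)
    set w := fillRow (contentTranspose f (r + 1)) c with hw
    have h1 := (fillRow_lt_iff (by rw [hdeg]; exact hc') (w + 1)).1 (Nat.lt_succ_self w)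
    have hwn : w < n := by
      rw [hw, fillRow_lt_iff (by rw [hdeg]; exact hc'), ← Finsupp.degree_eq_sum_range
        fun u hu => contentTranspose_of_ge f _ hu, hdeg]
      exact hc'
    have h2 := (hf.2.1 ⟨w, hwn⟩ r).2
    rw [Finset.sum_range_succ] at h1
    rw [Finsupp.add_apply, ← sum_range_contentTranspose, ← sum_range_contentTranspose,
      ← contentTranspose_val f] at h2
    exact (fillRow_lt_iff (by rw [hdeg]; exact hc'') w).2 (h1.trans_le h2)
  induction r', hr using Nat.le_induction with
  | base => exact step r hc
  | succ r' hr ih => exact (ih (ν.up_left_mem (Nat.le_succ r') le_rfl hc)).trans (step r' hc)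

theorem sum_rowContent_eq {ν : YoungDiagram} {T : ℕ → ℕ → ℕ} {t : ℕ →₀ ℕ}
    (hT : fillingContent ν.cells T = t) (v : ℕ) :
    ∑ r ∈ Finset.range (ν.colLen 0), rowContent (T r) (ν.rowLen r) v = t v := by
  rw [← hT, fillingContent_cells, Finsupp.finsetSum_apply]

/-- The number of entries `v` in each row of a tableau. -/
noncomputable def entryRows (ν : YoungDiagram) (T : ℕ → ℕ → ℕ) (v : ℕ) : ℕ →₀ ℕ :=
  Finsupp.onFinset (Finset.range (ν.colLen 0)) (fun r => rowContent (T r) (ν.rowLen r) v)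
    fun r hr => by
      by_contra hc
      rw [rowLen_eq_zero (by simpa using hc)] at hr
      simp [rowContent] at hr

theorem entryRows_apply (ν : YoungDiagram) (T : ℕ → ℕ → ℕ) (v r : ℕ) :
    entryRows ν T v r = rowContent (T r) (ν.rowLen r) v := rfl

theorem degree_entryRows {ν : YoungDiagram} {T : ℕ → ℕ → ℕ} {t : ℕ →₀ ℕ}
    (hT : fillingContent ν.cells T = t) (v : ℕ) : (entryRows ν T v).degree = t v := by
  rw [← sum_rowContent_eq hT, Finsupp.degree_eq_sum_range (N := ν.colLen 0)]
  · rfl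
  · intro r hr
    rw [entryRows_apply, rowLen_eq_zero hr]
    simp [rowContent]

theorem rowContent_eq_zero {ν : YoungDiagram} {T : ℕ → ℕ → ℕ} {t : ℕ →₀ ℕ}
    (hT : fillingContent ν.cells T = t) {v : ℕ} (hv : t v = 0) (r : ℕ) :
    rowContent (T r) (ν.rowLen r) v = 0 := by
  have := degree_entryRows hT v
  rw [hv, Finsupp.degree_eq_zero_iff] at this
  rw [← entryRows_apply, this]
  rfl

theorem contentTranspose_entryRows {ν : YoungDiagram} {T : ℕ → ℕ → ℕ} {t : ℕ →₀ ℕ}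
    (hT : fillingContent ν.cells T = t) {n : ℕ} (ht : ∀ j, n ≤ j → t j = 0) (r : ℕ) :
    contentTranspose (fun v : Fin n => entryRows ν T v) r = rowContent (T r) (ν.rowLen r) := by
  ext v
  rcases lt_or_ge v n with hv | hv
  · exact contentTranspose_val _ r ⟨v, hv⟩
  · rw [contentTranspose_of_ge _ _ hv, rowContent_eq_zero hT (ht v hv)]

/-- A semistandard tableau is determined by the number of entries `v` in row `r`, for all `v`
and `r`. -/
noncomputable def tableauEquiv (ν : YoungDiagram) {n : ℕ} {t : ℕ →₀ ℕ}
    (ht : ∀ j, n ≤ j → t j = 0) :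
    {T : SemistandardYoungTableau ν // fillingContent ν.cells T.entry = t} ≃
      {f : Fin n → ℕ →₀ ℕ // IsFilling IsStrip (fun _ _ => True) (fun j : Fin n => t j) f ∧
        ∑ k, f k = ν.rowLengths} where
  toFun T := ⟨fun v => entryRows ν T.1.entry v, by
    have htr := contentTranspose_entryRows T.2 ht
    refine ⟨⟨fun v => degree_entryRows T.2 v, fun v r => ⟨by simp, ?_⟩, fun _ _ _ => trivial⟩, ?_⟩
    · rw [Finsupp.add_apply, ← sum_range_contentTranspose, ← sum_range_contentTranspose, htr, htr,
        entryRows_apply, ← Finset.sum_range_succ, sum_range_rowContent, sum_range_rowContent]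
      refine Finset.card_le_card fun c hc => ?_
      rw [Finset.mem_filter, Finset.mem_range] at hc ⊢
      have h1 := mem_iff_lt_rowLen.2 hc.1
      have h2 := mem_iff_lt_rowLen.1 (ν.up_left_mem (Nat.le_succ r) le_rfl h1)
      have h3 := T.1.col_strict' (Nat.lt_succ_self r) h1
      exact ⟨h2, by simp only [Nat.succ_eq_add_one] at h3; omega⟩
    · ext r
      rw [← degree_contentTranspose, htr, degree_rowContent, rowLengths_apply]⟩
  invFun f := ⟨{
      entry := fun r c => if c < ν.rowLen r then fillRow (contentTranspose f.1 r) c else 0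
      row_weak' := by
        intro r c c' hc h
        rw [mem_iff_lt_rowLen] at h
        rw [if_pos h, if_pos (hc.trans h)]
        exact fillRow_mono hc.le (by rwa [degree_contentTranspose, f.2.2])
      col_strict' := by
        intro r r' c hr h
        rw [if_pos (mem_iff_lt_rowLen.1 h),
          if_pos (mem_iff_lt_rowLen.1 (ν.up_left_mem hr.le le_rfl h))]
        exact fillRow_contentTranspose_lt f.2.1 f.2.2 hr h
      zeros' := by
        intro r c h
        rw [mem_iff_lt_rowLen] at h
        rw [if_neg h] }, by
      have hrow : ∀ r, rowContent (fun c => if c < ν.rowLen r then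
          fillRow (contentTranspose f.1 r) c else 0) (ν.rowLen r) = contentTranspose f.1 r := by
        intro r
        have hd : (contentTranspose f.1 r).degree = ν.rowLen r := by
          rw [degree_contentTranspose, f.2.2, rowLengths_apply]
        conv_rhs => rw [← rowContent_fillRow (contentTranspose f.1 r), hd]
        refine Finset.sum_congr rfl fun c hc => ?_
        rw [Finset.mem_range] at hc
        simp [hc]
      rw [fillingContent_cells, Finset.sum_congr rfl fun r _ => hrow r]
      ext v
      rw [Finsupp.finsetSum_apply]
      rcases lt_or_ge v n with hv | hv
      · refine Eq.trans ?_ (f.2.1.1 ⟨v, hv⟩)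
        rw [Finsupp.degree_eq_sum_range (N := ν.colLen 0)]
        · exact Finset.sum_congr rfl fun r _ => contentTranspose_val f.1 r ⟨v, hv⟩
        · intro r hr
          have h1 : (f.1 ⟨v, hv⟩) r ≤ (∑ k, f.1 k) r :=
            (Finset.single_le_sum (f := f.1) (fun _ _ => zero_le) (Finset.mem_univ _) :) r
          rw [f.2.2, rowLengths_apply, rowLen_eq_zero hr] at h1
          omega
      · rw [ht v hv]
        exact Finset.sum_eq_zero fun r _ => contentTranspose_of_ge f.1 r hv⟩
  left_inv T := by
    refine Subtype.ext (SemistandardYoungTableau.ext fun r c => ?_)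
    change (if c < ν.rowLen r then _ else 0) = T.1.entry r c
    split_ifs with h
    · rw [contentTranspose_entryRows T.2 ht, fillRow_rowContent _ h]
      exact fun c c' hc hc' => T.1.row_weak' hc (mem_iff_lt_rowLen.2 hc')
    · exact (T.1.zeros' (by rwa [mem_iff_lt_rowLen])).symm
  right_inv f := by
    refine Subtype.ext (funext fun v => Finsupp.ext fun r => ?_)
    simp only [entryRows_apply]
    have hd : (contentTranspose f.1 r).degree = ν.rowLen r := by
      rw [degree_contentTranspose, f.2.2, rowLengths_apply]
    rw [← contentTranspose_val f.1 r v]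
    conv_rhs => rw [← rowContent_fillRow (contentTranspose f.1 r), hd]
    congr 1
    refine Finset.sum_congr rfl fun c hc => ?_
    rw [Finset.mem_range] at hc
    simp [hc]

end YoungDiagram

/-! ### Triangularity and linear independence of Schur functions -/

namespace YoungDiagram

theorem rowLengths_injective : Function.Injective rowLengths := fun ν κ h => by
  ext ⟨r, c⟩
  rw [mem_cells, mem_cells, mem_iff_lt_rowLen, mem_iff_lt_rowLen, ← rowLengths_apply, h,
    rowLengths_apply]

theorem exists_rowLengths_eq {κ : ℕ →₀ ℕ} (hκ : Antitone κ) :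
    ∃ ν : YoungDiagram, ν.rowLengths = κ := by
  obtain ⟨N, hN⟩ := κ.exists_forall_ge_eq_zero
  have hanti : Antitone fun i : Fin N => κ i := fun i j h => hκ h
  refine ⟨YoungDiagram.ofRowLens (List.ofFn fun i : Fin N => κ i) hanti.sortedGE_ofFn, ?_⟩
  ext r
  have h : ∀ c, c < (YoungDiagram.ofRowLens (List.ofFn fun i : Fin N => κ i)
      hanti.sortedGE_ofFn).rowLen r ↔ c < κ r := fun c => by
    rw [← mem_iff_lt_rowLen, mem_ofRowLens]
    simp only [List.length_ofFn, List.getElem_ofFn, exists_prop, and_iff_right_iff_imp]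
    intro hc
    by_contra hr
    rw [hN r (by omega)] at hc
    omega
  rw [rowLengths_apply]
  have h1 := h (κ r)
  have h2 := h ((YoungDiagram.ofRowLens (List.ofFn fun i : Fin N => κ i)
      hanti.sortedGE_ofFn).rowLen r)
  omega

theorem finite_degree_rowLengths_eq (d : ℕ) :
    {ν : YoungDiagram | ν.rowLengths.degree = d}.Finite := by
  refine Set.Finite.of_finite_image (f := rowLengths) ?_ rowLengths_injective.injOn
  refine (Set.finite_Iic (∑ r ∈ Finset.range d, Finsupp.single r d)).subset ?_
  rintro _ ⟨ν, hν, rfl⟩ r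
  have hν : ν.rowLengths.degree = d := hν
  have hle := hν ▸ ν.rowLengths.sum_range_le_degree (r + 1)
  have happ : (∑ r ∈ Finset.range d, Finsupp.single r d) r = if r < d then d else 0 := by
    simp [Finsupp.finsetSum_apply, Finsupp.single_apply]
  rw [happ]
  split_ifs with h
  · rw [Finset.sum_range_succ] at hle
    omega
  · by_contra hc
    have : ∑ u ∈ Finset.range (r + 1), 1 ≤ ∑ u ∈ Finset.range (r + 1), ν.rowLengths u :=
      Finset.sum_le_sum fun u hu => by
        rw [Finset.mem_range] at hu
        have := ν.rowLen_anti u r (by omega)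
        simp only [rowLengths_apply] at *
        omega
    simp only [Finset.sum_const, Finset.card_range, smul_eq_mul, mul_one] at this
    omega

theorem fillingContent_eq_rowLengths {ν : YoungDiagram} {T : ℕ → ℕ → ℕ}
    (hT : ∀ r c, (r, c) ∈ ν → T r c = r) : fillingContent ν.cells T = ν.rowLengths := by
  have h : ∀ r, rowContent (T r) (ν.rowLen r) = Finsupp.single r (ν.rowLen r) := fun r => by
    rw [rowContent, Finset.sum_congr rfl fun c hc => by
      rw [hT r c (mem_iff_lt_rowLen.2 (Finset.mem_range.1 hc))]]
    simp
  rw [fillingContent_cells, Finset.sum_congr rfl fun r _ => h r]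
  ext r
  simp only [Finsupp.finsetSum_apply, Finsupp.single_apply, Finset.sum_ite_eq', Finset.mem_range,
    rowLengths_apply, ite_eq_left_iff, not_lt]
  exact fun hr => (rowLen_eq_zero hr).symm

theorem _root_.SemistandardYoungTableau.le_entry {ν : YoungDiagram} (T : SemistandardYoungTableau ν)
    {r c : ℕ} (h : (r, c) ∈ ν) : r ≤ T.entry r c := by
  induction r with
  | zero => exact Nat.zero_le _
  | succ r ih =>
    have h1 := ih (ν.up_left_mem (Nat.le_succ r) le_rfl h)
    have h2 := T.col_strict' (Nat.lt_succ_self r) h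
    simp only [Nat.succ_eq_add_one] at h2
    omega

theorem _root_.weight_fillingContent (s : Finset (ℕ × ℕ)) (T : ℕ → ℕ → ℕ) :
    Finsupp.weight (id : ℕ → ℕ) (fillingContent s T) = ∑ x ∈ s, T x.1 x.2 := by
  simp [fillingContent, Finsupp.weight_single]

/-- Each entry is at least its row index, while the sum of all entries is the sum of row indices
over `ν`. The hypothesis `hle` forces equality everywhere, so the content of `T` is also the
sequence of row lengths of `κ`. -/
theorem eq_of_tableau {κ ν : YoungDiagram} (T : SemistandardYoungTableau κ)
    (hT : fillingContent κ.cells T.entry = ν.rowLengths)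
    (hle : ∑ x ∈ ν.cells, x.1 ≤ ∑ x ∈ κ.cells, x.1) : κ = ν := by
  have h1 := weight_fillingContent κ.cells T.entry
  have h2 := weight_fillingContent ν.cells fun r _ => r
  rw [fillingContent_eq_rowLengths fun _ _ _ => rfl, ← hT, h1] at h2
  have h3 : ∀ x ∈ κ.cells, x.1 ≤ T.entry x.1 x.2 := fun x hx => T.le_entry hx
  have h4 := (Finset.sum_eq_sum_iff_of_le h3).1 (le_antisymm (Finset.sum_le_sum h3) (h2 ▸ hle))
  refine rowLengths_injective ?_
  rw [← hT]
  exact (fillingContent_eq_rowLengths fun r c h => (h4 (r, c) ((mem_cells _).2 h)).symm).symm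

theorem finite_tableau_content (ν : YoungDiagram) (t : ℕ →₀ ℕ) :
    Finite {T : SemistandardYoungTableau ν // fillingContent ν.cells T.entry = t} := by
  obtain ⟨n, hn⟩ := t.exists_forall_ge_eq_zero
  have := finite_filling IsStrip (fun _ _ => True) (fun j : Fin n => t j) ν.rowLengths
  exact Finite.of_equiv _ (tableauEquiv ν hn).symm

end YoungDiagram

theorem sum_smul_schur_apply (c : YoungDiagram →₀ ℤ) (t : ℕ →₀ ℕ) :
    (c.sum fun κ a => a • schur κ) t = ∑ κ ∈ c.support, c κ * schur κ t := by
  change MvPowerSeries.coeff t (c.sum fun κ a => a • schur κ) = _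
  rw [Finsupp.sum, map_sum]
  refine Finset.sum_congr rfl fun κ _ => ?_
  rw [map_zsmul, smul_eq_mul]
  rfl

/-- The Schur functions are linearly independent. -/
theorem sum_smul_schur_injective {c c' : YoungDiagram →₀ ℤ}
    (h : (c.sum fun κ a => a • schur κ) = c'.sum fun κ a => a • schur κ) : c = c' := by
  rw [← sub_eq_zero, ← Finsupp.sum_sub_index fun _ _ _ => sub_smul _ _ _] at h
  rw [← sub_eq_zero]
  generalize c - c' = d at h
  by_contra hd
  -- For `ν` minimizing the sum of row indices, `eq_of_tableau` leaves only `schur ν` to contribute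
  -- to the coefficient at `ν.rowLengths`, and the highest weight tableau makes it nonzero.
  obtain ⟨ν, hν, hmin⟩ := Finset.exists_min_image d.support (fun κ => ∑ x ∈ κ.cells, x.1)
    (Finsupp.support_nonempty_iff.2 hd)
  have h1 := sum_smul_schur_apply d ν.rowLengths
  rw [h, Finset.sum_eq_single ν] at h1
  · have := YoungDiagram.finite_tableau_content ν ν.rowLengths
    have hne : Nonempty {T : SemistandardYoungTableau ν //
        fillingContent ν.cells T.entry = ν.rowLengths} :=
      ⟨⟨.highestWeight ν, YoungDiagram.fillingContent_eq_rowLengths fun r c h => if_pos h⟩⟩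
    have hpos : 0 < Nat.card {T : SemistandardYoungTableau ν //
        fillingContent ν.cells T.entry = ν.rowLengths} := Nat.card_pos
    have h2 : d ν * schur ν ν.rowLengths = 0 := h1.symm
    rcases mul_eq_zero.1 h2 with h3 | h3
    · exact Finsupp.mem_support_iff.1 hν h3
    · exact hpos.ne' (Nat.cast_eq_zero.1 (h3 : ((Nat.card _ : ℕ) : ℤ) = 0))
  · intro κ hκ hne
    have : IsEmpty {T : SemistandardYoungTableau κ //
        fillingContent κ.cells T.entry = ν.rowLengths} :=
      ⟨fun T => hne (YoungDiagram.eq_of_tableau T.1 T.2 (hmin κ hκ))⟩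
    simp [schur]
  · exact fun h => absurd hν h

/-! ### The Schur support of a ribbon in terms of chains -/

namespace Ribbon

variable {m : ℕ}

/-- The coefficient of the Schur function of `ν` in the ribbon Schur function of `α`. -/
noncomputable def schurCoeff (α : Fin m → ℕ) (ν : YoungDiagram) : ℕ :=
  Nat.card {f // IsFilling IsStrip Ascends α f ∧ ∑ k, f k = ν.rowLengths}

theorem schurCoeff_pos_iff {α : Fin m → ℕ} {ν : YoungDiagram} :
    0 < schurCoeff α ν ↔ ∃ f, IsFilling IsStrip Ascends α f ∧ ∑ k, f k = ν.rowLengths := by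
  have := finite_filling IsStrip Ascends α ν.rowLengths
  rw [schurCoeff, Nat.card_pos_iff, and_iff_left this, nonempty_subtype]

theorem finite_schurCoeff (α : Fin m → ℕ) : {ν | schurCoeff α ν ≠ 0}.Finite := by
  refine (YoungDiagram.finite_degree_rowLengths_eq (∑ k, α k)).subset fun ν hν => ?_
  obtain ⟨f, h1, h2⟩ := schurCoeff_pos_iff.1 (Nat.pos_of_ne_zero hν)
  simp only [Set.mem_ofPred_eq, ← h2, map_sum, h1.1]

theorem antitone_of_isFilling {Q : (ℕ →₀ ℕ) → (ℕ →₀ ℕ) → Prop} {α : Fin m → ℕ}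
    {f : Fin m → ℕ →₀ ℕ} (hf : IsFilling IsStrip Q α f) : Antitone (⇑(∑ k, f k : ℕ →₀ ℕ)) := by
  rcases m with _ | m
  · intro a b _; simp
  have h := hf.2.1 (Fin.last m)
  have hs : ∑ j ∈ Finset.Iio (Fin.last m), f j + f (Fin.last m) = ∑ k, f k := by
    rw [Fin.sum_univ_castSucc, Fin.Iio_last_eq_map, Finset.sum_map]
    rfl
  rw [IsStrip, hs] at h
  exact antitone_nat_of_succ_le fun r => (h r).2.trans (h r).1

/-- The expansion of ribbon Schur functions into Schur functions. -/
theorem skewSchur_shape (α : Fin m → ℕ) (hα : ∀ k, 2 ≤ α k) :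
    skewSchur (shape α) = (Finsupp.ofSupportFinite (fun ν => (schurCoeff α ν : ℤ))
      ((finite_schurCoeff α).subset fun ν hν => by simpa using hν)).sum fun κ a => a • schur κ := by
  set c := Finsupp.ofSupportFinite (fun ν => (schurCoeff α ν : ℤ))
      ((finite_schurCoeff α).subset fun ν hν => by simpa using hν) with hc
  have hc_apply : ∀ ν, c ν = schurCoeff α ν := fun ν => rfl
  funext t
  obtain ⟨n, hn⟩ := t.exists_forall_ge_eq_zero
  have key := fillingCount_eq_tsum_kostka α (fun k => by have := hα k; omega) hn
  rw [fillingCount_eq_card, ← Nat.card_congr (tableauEquiv hα t)] at key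
  -- The sum runs over all sequences `κ`, but a nonzero count forces `κ` to be weakly decreasing,
  -- hence to be the row lengths of a diagram.
  rw [← YoungDiagram.rowLengths_injective.tsum_eq (f := fun κ => fillingCount IsStrip Ascends α κ *
    kostka (fun j : Fin n => t j) κ)] at key
  swap
  · intro κ hκ
    have h1 : fillingCount IsStrip Ascends α κ ≠ 0 := left_ne_zero_of_mul hκ
    rw [fillingCount_eq_card, Nat.cast_ne_zero] at h1
    obtain ⟨⟨f, hf, rfl⟩⟩ := (Nat.card_ne_zero.1 h1).1
    exact YoungDiagram.exists_rowLengths_eq (antitone_of_isFilling hf)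
  have hK : ∀ ν : YoungDiagram, kostka (fun j : Fin n => t j) ν.rowLengths =
      (Nat.card {T : SemistandardYoungTableau ν // fillingContent ν.cells T.entry = t} : ENNReal) :=
    fun ν => by
      rw [kostka, fillingCount_eq_card, Nat.card_congr (YoungDiagram.tableauEquiv ν hn)]
  simp_rw [hK, fillingCount_eq_card] at key
  rw [tsum_eq_sum (s := c.support) fun ν hν => by
    rw [Finsupp.notMem_support_iff, hc_apply, Nat.cast_eq_zero, schurCoeff] at hν
    rw [hν]; simp] at key
  rw [sum_smul_schur_apply]
  simp only [hc_apply, skewSchur, schur]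
  have key' : Nat.card {T : SkewTableau (shape α) // fillingContent (shape α).cells T.entry = t} =
      ∑ ν ∈ c.support, schurCoeff α ν *
        Nat.card {T : SemistandardYoungTableau ν // fillingContent ν.cells T.entry = t} := by
    simp only [schurCoeff]
    exact_mod_cast key
  rw [key']
  push_cast
  rfl

theorem mem_schurSupport_shape_iff {α : Fin m → ℕ} (hα : ∀ k, 2 ≤ α k) {ν : YoungDiagram} :
    ν ∈ schurSupport (shape α) ↔ ∃ f, IsFilling IsStrip Ascends α f ∧ ∑ k, f k = ν.rowLengths := by
  rw [← schurCoeff_pos_iff]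
  constructor
  · rintro ⟨c, h1, h2⟩
    rw [skewSchur_shape α hα] at h1
    rw [← sum_smul_schur_injective h1] at h2
    exact Int.natCast_pos.1 h2
  · intro h
    exact ⟨_, skewSchur_shape α hα, Int.natCast_pos.2 h⟩

/-- The row lengths, extended by zero. -/
def extend (α : Fin m → ℕ) (k : ℕ) : ℕ := if h : k < m then α ⟨k, h⟩ else 0

theorem extend_val (α : Fin m → ℕ) (k : Fin m) : extend α k = α k := by simp [extend]

theorem sum_val_lt_succ {M : Type*} [AddCommMonoid M] (f : Fin m → M) {k : ℕ} (h : k < m) :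
    ∑ j with j.val < k + 1, f j = ∑ j with j.val < k, f j + f ⟨k, h⟩ := by
  rw [add_comm _ (f ⟨k, h⟩), ← Finset.sum_insert (by simp)]
  refine Finset.sum_congr ?_ fun _ _ => rfl
  ext j
  simp only [Finset.mem_filter, Finset.mem_univ, true_and, Finset.mem_insert, Fin.ext_iff]
  omega

theorem sum_val_lt {M : Type*} [AddCommMonoid M] (f : Fin m → M) (k : Fin m) :
    ∑ j with j.val < k.val, f j = ∑ j ∈ Finset.Iio k, f j := by
  refine Finset.sum_congr ?_ fun _ _ => rfl
  ext j
  simp only [Finset.mem_filter, Finset.mem_univ, true_and, Finset.mem_Iio, Fin.lt_def]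

/-- Partial sums turn blocks into a chain, and differences recover them; the truncated subtraction
is exact because the chain increases. -/
theorem exists_filling_iff_exists_chain {α : Fin m → ℕ} {κ : ℕ →₀ ℕ} :
    (∃ f, IsFilling IsStrip Ascends α f ∧ ∑ k, f k = κ) ↔
      ∃ L, StripChain m (extend α) L ∧
        (∀ j, j + 1 < m → StripAscent (L j) (L (j + 1)) (L (j + 2))) ∧ L m = κ := by
  constructor
  · rintro ⟨f, hf, rfl⟩
    set L : ℕ → ℕ →₀ ℕ := fun k => ∑ j with j.val < k, f j with hL
    have hsucc : ∀ k (h : k < m), L (k + 1) = L k + f ⟨k, h⟩ := fun k h => sum_val_lt_succ f h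
    refine ⟨L, ⟨by simp [hL], fun k hk => ?_, fun k hk => ?_⟩, fun k hk => ?_, ?_⟩
    · rw [hsucc k hk, show L k = _ from sum_val_lt f ⟨k, hk⟩]
      exact hf.2.1 ⟨k, hk⟩
    · rw [hsucc k hk, map_add, hf.1, extend, dif_pos hk]
    · obtain ⟨u, v, h1, h2, h3⟩ := hf.2.2 ⟨k, by omega⟩ ⟨k + 1, hk⟩ rfl
      refine ⟨u, v, h1, ?_, ?_⟩
      · rw [hsucc k (by omega), Finsupp.add_apply]; omega
      · rw [hsucc (k + 1) hk, Finsupp.add_apply]; omega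
    · rw [hL]; simp
  · rintro ⟨L, hL, hasc, rfl⟩
    set f : Fin m → ℕ →₀ ℕ := fun k => L (k + 1) - L k with hf
    have hadd : ∀ k : Fin m, L k + f k = L (k + 1) := fun k =>
      add_tsub_cancel_of_le fun r => (hL.interlace k k.2 r).1
    have hsum : ∀ k ≤ m, ∑ j : Fin m with j.val < k, f j = L k := by
      intro k hk
      induction k with
      | zero => simp [hL.zero]
      | succ k ih =>
        rw [sum_val_lt_succ f hk, ih (by omega)]
        exact hadd ⟨k, hk⟩
    have hIio : ∀ k : Fin m, ∑ j ∈ Finset.Iio k, f j = L k := fun k => by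
      rw [← sum_val_lt, hsum k k.2.le]
    have hf_ne : ∀ (k : Fin m) r, f k r ≠ 0 ↔ L k r < L (k + 1) r := fun k r => by
      simp only [hf, Finsupp.tsub_apply]; omega
    refine ⟨f, ⟨fun k => ?_, fun k => ?_, fun k k' hk => ?_⟩, ?_⟩
    · have h1 := congrArg Finsupp.degree (hadd k)
      have h2 := hL.degree k k.2
      rw [map_add] at h1
      rw [extend_val] at h2
      omega
    · rw [hIio, IsStrip, hadd]
      exact hL.interlace k k.2
    · obtain ⟨u, v, h1, h2, h3⟩ := hasc k (by have := k'.2; omega)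
      refine ⟨u, v, h1, (hf_ne k u).2 h2, (hf_ne k' v).2 ?_⟩
      rw [hk]
      exact h3
    · rw [← hsum m le_rfl]
      refine Finset.sum_congr ?_ fun _ _ => rfl
      ext j
      simp

theorem extend_permute_swap (α : Fin m → ℕ) (i j : Fin m) :
    extend (permute α (Equiv.swap i j)) = extend α ∘ Equiv.swap i.val j.val := by
  funext k
  by_cases hk : k < m
  · have h : Equiv.swap i.val j.val k = (Equiv.swap i j ⟨k, hk⟩).val :=
      (Fin.val_injective.map_swap (x := i) (y := j) (z := ⟨k, hk⟩)).symm
    rw [Function.comp_apply, h, extend_val, extend, dif_pos hk, permute, Equiv.swap_inv]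
  · rw [Function.comp_apply, Equiv.swap_apply_of_ne_of_ne (by have := i.2; omega)
      (by have := j.2; omega), extend, extend, dif_neg hk, dif_neg hk]

end Ribbon

/-- In the hypotheses, `j` is the index `i + 1`, and `h` is the index `i - 1` when `i` is not the
top row; for the top row the second inequality is void, as `α_0 = ∞`. -/
theorem mainTheorem2 (m : ℕ) (hm : 3 ≤ m) (α : Fin m → ℕ) (hα : ∀ k, 2 ≤ α k)
    (i j : Fin m) (hij : j.val = i.val + 1) (hgt : α j < α i)
    (htri : ∀ h : Fin m, h.val + 1 = i.val → α i < α h + α j) :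
    schurSupport (Ribbon.shape α) ⊆
      schurSupport (Ribbon.shape (Ribbon.permute α (Equiv.swap i j))) := by
  intro ν hν
  rw [Ribbon.mem_schurSupport_shape_iff hα, Ribbon.exists_filling_iff_exists_chain] at hν
  rw [Ribbon.mem_schurSupport_shape_iff (α := Ribbon.permute α _) fun k => hα _,
    Ribbon.exists_filling_iff_exists_chain, Ribbon.extend_permute_swap, hij]
  obtain ⟨L, hL, hasc, hLm⟩ := hν
  have hj := j.2
  have ei := Ribbon.extend_val α i
  have ej := Ribbon.extend_val α j
  rw [hij] at ej
  obtain ⟨L', h1, h2, h3⟩ := hL.exists_swap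
    (fun k hk => by rw [Ribbon.extend, dif_pos hk]; exact hα _) (i := i) (by omega)
    (by rw [ei, ej]; exact hgt) (fun hi => by
      have hlt : i.val - 1 < m := by omega
      rw [ei, ej, show Ribbon.extend α (i.val - 1) = α ⟨i.val - 1, hlt⟩ from dif_pos hlt]
      exact htri _ (by simp only; omega)) hasc
  exact ⟨L', h1, h2, h3.trans hLm⟩
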